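/- Let $\mathcal I_1,\mathcal I_2\subset\mathbb R$ be compact, and let $(Y_i,X_i)$, $i=1,2,\dots$, be pairs of random curves on $\mathcal I_1$ and $\mathcal I_2$ (jointly measurable in the sample point and the argument) with $\mathbb E\{Y_i(u)\}=0$ for all $u\in\mathcal I_1$ and $\mathbb E\{X_i(v)\}=0$ for all $v\in\mathcal I_2$. Suppose that the sequence $\{(Y_i,X_i)\}_{i\ge1}$ is strictly stationary and $\psi$-mixing with $\sum_{k\ge1}k\,\psi(k)^{1/2}<\infty$, where $$\psi(k)=\sup_{m}\ \sup\Bigl\{\Bigl|1-\frac{P(B\mid A)}{P(B)}\Bigr| : A\in\sigma\{(Y_i,X_i):i\le m\},\ B\in\sigma\{(Y_i,X_i):i\ge m+k\},\ P(A)P(B)>0\Bigr\},$$ and that $\mathbb E\bigl\{\int_{\mathcal I_1}Y_i(u)^2du+\int_{\mathcal I_2}X_i(v)^2dv\bigr\}^2<\infty$. Let $\Sigma(u,v)=\mathrm{cov}\{Y_i(u),X_i(v)\}$. For a kernel $K$ on $\mathcal I_1\times\mathcal I_2$, let $\lambda_j(K)$, $j\ge1$, be the $j$-th largest eigenvalue,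 counted with multiplicity, of the operator on $L_2(\mathcal I_1)$ with kernel $M(u,u')=\int_{\mathcal I_2}K(u,z)K(u',z)\,dz$, where $\lambda_j(K)=0$ if there are fewer than $j$ positive eigenvalues; thus $\lambda_j(K)$ is the $j$-th largest squared singular value of $K$. Put $\lambda_j=\lambda_j(\Sigma)$ and suppose that $\lambda_1>\dots>\lambda_r>0=\lambda_{r+1}=\lambda_{r+2}=\cdots$; the integer $r\ge 0$ is the correlation dimension. Let $\widehat\lambda_j=\lambda_j(\widehat\Sigma)$ with $$\widehat\Sigma(u,v)=\frac1n\sum_{i=1}^n\{Y_i(u)-\bar Y(u)\}\{X_i(v)-\bar X(v)\},\qquad \bar Y=\frac1n\sum_{i=1}^nY_i,\quad \bar X=\frac1n\sum_{i=1}^nX_i .$$ Let $d>r$ be an integer, with $r$ and $d$ not depending on $n$, let $c_*,\tau_1,\tau_2>0$ be constants, let $g(n)>0$ satisfy $n\,g(n)\to\infty$ and $g(n)\to0$ as $n\to\infty$, and put $$IC_1(q)=\frac1{d^2}\sum_{k=q+1}^d\widehat\lambda_k+\tau_1\,q\,g(n),\qquad IC_2(q)=\log\Bigl(c_*+\frac1{d^2}\sum_{k=q+1}^d\widehat\lambda_k\Bigr)+\tau_2\,q\,g(n).$$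 Then, for $i=1,2$ and every $0\le q<d$ with $q\ne r$, $P\{IC_i(r)<IC_i(q)\}\to1$ as $n\to\infty$. Consequently, any minimiser $\widehat r$ of $IC_i(q)$ over $0\le q<d$ satisfies $P(\widehat r=r)\to1$, i.e. $\widehat r$ is a consistent estimator of $r$. -/

import Mathlib

open MeasureTheory ProbabilityTheory Filter Topology
open scoped ENNReal

-- a subset of the line carries Lebesgue measure
attribute [local instance] MeasureTheory.Measure.Subtype.measureSpace

noncomputable section

namespace CurveReg

/-! ### Dependence of a random sequence -/

section Dependence

variable {Ω E : Type*} [MeasurableSpace Ω] [MeasurableSpace E]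

/-- Strict stationarity of `Z 0, Z 1, …`: every time shift leaves the joint law of the whole
sequence unchanged. For a sequence of random functions, `E` carries the product σ-algebra, and this
is invariance of all finite-dimensional distributions. -/
def StrictlyStationary (P : Measure Ω) (Z : ℕ → Ω → E) : Prop :=
  ∀ h : ℕ, IdentDistrib (fun ω i => Z (i + h) ω) (fun ω i => Z i ω) P P

/-- The σ-algebra of the past up to time `m`. -/
abbrev pastSigma (Z : ℕ → Ω → E) (m : ℕ) : MeasurableSpace Ω :=
  ⨆ i : ℕ, ⨆ _ : i ≤ m, MeasurableSpace.comap (Z i) inferInstance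

/-- The σ-algebra of the future from time `m` on. -/
abbrev futureSigma (Z : ℕ → Ω → E) (m : ℕ) : MeasurableSpace Ω :=
  ⨆ i : ℕ, ⨆ _ : m ≤ i, MeasurableSpace.comap (Z i) inferInstance

/-- The `ψ`-mixing coefficient: the supremum of `|1 - P(B ∣ A) / P(B)|` over all events `A` of the
past up to some time `m` and `B` of the future from time `m + k` on, both of positive probability.
It may be infinite. -/
def psiMixing (P : Measure Ω) (Z : ℕ → Ω → E) (k : ℕ) : ℝ≥0∞ :=
  ⨆ (m : ℕ) (A : Set Ω) (B : Set Ω)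
    (_ : MeasurableSet[pastSigma Z m] A) (_ : MeasurableSet[futureSigma Z (m + k)] B)
    (_ : P A ≠ 0) (_ : P B ≠ 0),
    ENNReal.ofReal |1 - P.real (A ∩ B) / P.real A / P.real B|

/-- The event `A n` has probability tending to one. For measurable events the two parts are
equivalent; together they say that inner and outer probabilities tend to one, so that no question
of measurability arises. -/
def ProbTendsToOne (P : Measure Ω) (A : ℕ → Set Ω) : Prop :=
  Tendsto (fun n => P (A n)) atTop (𝓝 1) ∧ Tendsto (fun n => P (A n)ᶜ) atTop (𝓝 0)

end Dependence

/-! ### Covariance kernels and their spectral values -/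

section Kernels

variable {Ω S T : Type*} [MeasurableSpace Ω] [MeasureSpace S] [MeasureSpace T]

/-- The cross-covariance function `Σ(u, v) = cov{Y(u), X(v)}` of two random functions. -/
def crossCov (P : Measure Ω) (Y : Ω → S → ℝ) (X : Ω → T → ℝ) (u : S) (v : T) : ℝ :=
  covariance (fun ω => Y ω u) (fun ω => X ω v) P

/-- The pointwise mean of the first `n` curves of a sequence. -/
def sampleMean {R : Type*} (y : ℕ → R → ℝ) (n : ℕ) (u : R) : ℝ :=
  (1 / (n : ℝ)) * ∑ i ∈ Finset.range n, y i u

/-- The sample cross-covariance function of the first `n` pairs of curves,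
`(1/n) ∑ (y i u - ȳ u) (x i v - x̄ v)`. -/
def sampleCrossCov (y : ℕ → S → ℝ) (x : ℕ → T → ℝ) (n : ℕ) (u : S) (v : T) : ℝ :=
  (1 / (n : ℝ)) *
    ∑ i ∈ Finset.range n, (y i u - sampleMean y n u) * (x i v - sampleMean x n v)

/-- The kernel `M(u, u') = ∫ K(u, z) K(u', z) dz` of the operator `K K*`. -/
def squareKernel (K : S → T → ℝ) (u u' : S) : ℝ :=
  ∫ z : T, K u z * K u' z

/-- `f` satisfies the eigen-equation `∫ M(u, z) f(z) dz = θ f(u)` in `L²`. -/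
def IsEigenfunction (M : S → S → ℝ) (θ : ℝ) (f : Lp ℝ 2 (volume : Measure S)) : Prop :=
  ∀ᵐ u : S, ∫ z : S, M u z * f z = θ * f u

/-- The `j`-th largest eigenvalue (`j = 1, 2, …`), counted with multiplicity, of the non-negative
integral operator with symmetric kernel `M`; it is `0` if there are fewer than `j` positive
eigenvalues. It is the largest `t > 0` for which there are `j` orthonormal eigenfunctions
with eigenvalues at least `t`. -/
def nthEigenvalue (M : S → S → ℝ) (j : ℕ) : ℝ :=
  sSup {t : ℝ | 0 < t ∧ ∃ (φ : Fin j → Lp ℝ 2 (volume : Measure S)) (θ : Fin j → ℝ),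
    Orthonormal ℝ φ ∧ ∀ i, t ≤ θ i ∧ IsEigenfunction M (θ i) (φ i)}

/-- The `j`-th largest squared singular value `λ_j` of the kernel `K`, `j = 1, 2, …`: the `j`-th
largest eigenvalue of the operator `K K*`. -/
def lam (K : S → T → ℝ) (j : ℕ) : ℝ :=
  nthEigenvalue (squareKernel K) j

/-- The estimator of `λ_j` computed from the first `n` pairs of curves. -/
def lamHat (Y : ℕ → Ω → S → ℝ) (X : ℕ → Ω → T → ℝ) (n : ℕ) (ω : Ω) (j : ℕ) : ℝ :=
  lam (sampleCrossCov (fun i => Y i ω) (fun i => X i ω) n) j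

end Kernels

/-! ### The information criteria -/

/-- `IC₁(q) = d⁻² ∑_{k=q+1}^d l_k + τ q γ`, where `γ` is the value of the penalty. -/
def IC₁ (d : ℕ) (τ γ : ℝ) (l : ℕ → ℝ) (q : ℕ) : ℝ :=
  1 / (d : ℝ) ^ 2 * ∑ k ∈ Finset.Icc (q + 1) d, l k + τ * q * γ

/-- `IC₂(q) = log (c + d⁻² ∑_{k=q+1}^d l_k) + τ q γ`, where `γ` is the value of the penalty. -/
def IC₂ (d : ℕ) (c τ γ : ℝ) (l : ℕ → ℝ) (q : ℕ) : ℝ :=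
  Real.log (c + 1 / (d : ℝ) ^ 2 * ∑ k ∈ Finset.Icc (q + 1) d, l k) + τ * q * γ

/-- `q` minimises `IC` over `{0, …, d - 1}`. -/
def IsArgmin (d : ℕ) (IC : ℕ → ℝ) (q : ℕ) : Prop :=
  q < d ∧ ∀ q' < d, IC q ≤ IC q'

end CurveReg

end

/-! The discarded spectral values are small to second order. By Weyl's inequality for singular
values (`sqrt_lam_le_add`), `√λ_j` changes by at most the Hilbert–Schmidt norm of the perturbation.
Where `λ_k(Σ) = 0` this gives `λ̂_k ≤ ‖Σ̂ - Σ‖²`, a squared error of order `1/n`. Since `n g(n) →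
∞`, a penalty step of order `g(n)` beats this noise, so `q > r` loses. For `q < r` the criterion
keeps `λ̂_r`, which stays above `λ_r / 4`, while all penalties vanish because `g(n) → 0`, so `q < r`
loses too.

The rate (`tendsto_measure_covError`) comes from `ψ`-mixing: `|cov(f, g)| ≤ ψ(k) E|f| E|g|` across a
gap `k` (`abs_covariance_le_of_psiMixing`). Summability of `ψ` then bounds the variance of a sample
mean by `C/n` times the second moment, at each argument separately. Tonelli's theorem integrates
this over the arguments. It is applied to the tensors `Y_i(u) X_i(v)` and, to control the centring
term `Ȳ X̄`, to the curves themselves.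

Weyl's inequality has to produce genuine eigenfunctions, because the spectral values are defined
through them. Hence the Courant–Fischer step `exists_orthonormal_eigenvectors` and the need for
compact operators. Sample covariances have finite rank. `Σ` gives a compact operator because
consistency itself supplies realisations of `Σ̂` arbitrarily close to it.

Measurability of `λ̂_j` is never needed: everything happens outside exceptional events defined
through the Hilbert–Schmidt error (`exists_exceptional_events`). -/

noncomputable section

namespace CurveReg

/-! ### Eigenvectors of compact positive operators. -/

section Hilbert

variable {H : Type*} [NormedAddCommGroup H] [InnerProductSpace ℝ H] [CompleteSpace H]

/-- A compact positive operator attains its norm at a unit eigenvector. -/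
lemma exists_unit_eigenvector_norm {T : H →L[ℝ] H} (hT : IsCompactOperator T)
    (hsymm : T.IsSymmetric) (hpos : ∀ f, 0 ≤ inner ℝ (T f) f) (h0 : T ≠ 0) :
    ∃ e : H, ‖e‖ = 1 ∧ T e = ‖T‖ • e := by
  have hne : Nontrivial H := by
    by_contra h
    rw [not_nontrivial_iff_subsingleton] at h
    exact h0 (ContinuousLinearMap.ext fun x => Subsingleton.elim _ _)
  have hn : ‖T‖ ≠ 0 := norm_ne_zero_iff.mpr h0
  -- If `‖T‖` were in the resolvent set, the Rayleigh quotients would stay below `‖T‖ - ε`. By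
  -- positivity and symmetry their supremum is `‖T‖`.
  have hspec : ‖T‖ ∈ spectrum ℝ T := by
    by_contra h
    have h' : algebraMap ℝ ℝ ‖T‖ ∈ resolventSet ℝ T := by
      simpa [spectrum] using h
    obtain ⟨ε, hε, hle⟩ := T.rayleighQuotient_le_of_norm_mem_resolventSet h'
    have h1 : ‖T‖ ≤ ‖T‖ - ε := by
      conv_lhs => rw [T.norm_eq_iSup_rayleighQuotient hsymm]
      refine ciSup_le fun x => ?_
      rw [abs_of_nonneg]
      · exact hle x
      · simp only [ContinuousLinearMap.rayleighQuotient, ContinuousLinearMap.reApplyInnerSelf]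
        exact div_nonneg (by simpa using hpos x) (sq_nonneg _)
    linarith
  obtain ⟨v, hv⟩ := ((hT.hasEigenvalue_iff_mem_spectrum hn).mpr hspec).exists_hasEigenvector
  have hv0 : ‖v‖ ≠ 0 := norm_ne_zero_iff.mpr hv.2
  refine ⟨‖v‖⁻¹ • v, by simp [norm_smul, hv0], ?_⟩
  have : T v = ‖T‖ • v := hv.apply_eq_smul
  rw [map_smul, this, smul_comm]

/-- One half of the Courant–Fischer principle: a compact positive operator whose quadratic form is
at least `s > 0` on the span of `j` linearly independent vectors has `j` orthonormal eigenvectors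
with eigenvalues at least `s`. -/
lemma exists_orthonormal_eigenvectors {T : H →L[ℝ] H} (hT : IsCompactOperator T)
    (hsymm : T.IsSymmetric) (hpos : ∀ f, 0 ≤ inner ℝ (T f) f) {j : ℕ} {ψ : Fin j → H}
    (hψ : LinearIndependent ℝ ψ) {s : ℝ} (hs : 0 < s)
    (hV : ∀ f ∈ Submodule.span ℝ (Set.range ψ), s * ‖f‖ ^ 2 ≤ inner ℝ (T f) f) :
    ∃ (φ : Fin j → H) (θ : Fin j → ℝ), Orthonormal ℝ φ ∧ ∀ i, s ≤ θ i ∧ T (φ i) = θ i • φ i := by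
  -- Deflation: eigenvectors are found one at a time, while the `j`-dimensional test space stays
  -- fixed.
  suffices h : ∀ i ≤ j, ∃ (φ : Fin i → H) (θ : Fin i → ℝ),
      Orthonormal ℝ φ ∧ ∀ k, s ≤ θ k ∧ T (φ k) = θ k • φ k from h j le_rfl
  intro i
  induction i with
  | zero => exact fun _ => ⟨Fin.elim0, Fin.elim0, ⟨fun i => i.elim0, fun i => i.elim0⟩,
      fun i => i.elim0⟩
  | succ i ih =>
    intro hij
    obtain ⟨φ, θ, hφ, hθ⟩ := ih (by omega)
    set W : Submodule ℝ H := Submodule.span ℝ (Set.range φ) with hW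
    set V : Submodule ℝ H := Submodule.span ℝ (Set.range ψ) with hVdef
    have : FiniteDimensional ℝ W := FiniteDimensional.span_of_finite ℝ (Set.finite_range φ)
    have : FiniteDimensional ℝ V := FiniteDimensional.span_of_finite ℝ (Set.finite_range ψ)
    set Q : H →L[ℝ] H := Wᗮ.starProjection with hQ
    have hTW : ∀ f ∈ Wᗮ, T f ∈ Wᗮ := by
      intro f hf
      rw [hW, Submodule.mem_orthogonal] at hf ⊢
      intro u hu
      induction hu using Submodule.span_induction with
      | mem x hx =>
        obtain ⟨k, rfl⟩ := hx
        have h1 : inner ℝ (φ k) (T f) = inner ℝ (T (φ k)) f := (hsymm (φ k) f).symm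
        rw [h1, (hθ k).2, inner_smul_left, hf _ (Submodule.subset_span ⟨k, rfl⟩), mul_zero]
      | zero => simp
      | add x y _ _ hx hy => rw [inner_add_left, hx, hy, add_zero]
      | smul a x _ hx => rw [inner_smul_left, hx, mul_zero]
    -- a vector of the test space orthogonal to the eigenvectors already found
    obtain ⟨f, hfV, hfW, hf0⟩ : ∃ f ∈ V, f ∈ Wᗮ ∧ f ≠ 0 := by
      set L : V →ₗ[ℝ] W := (W.orthogonalProjectionOnto : H →ₗ[ℝ] W) ∘ₗ V.subtype with hL
      have hker : LinearMap.ker L ≠ ⊥ := by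
        apply LinearMap.ker_ne_bot_of_finrank_lt
        rw [hW, hVdef, finrank_span_eq_card hψ, finrank_span_eq_card hφ.linearIndependent]
        simpa using hij
      obtain ⟨x, hx, hx0⟩ := Submodule.exists_mem_ne_zero_of_ne_bot hker
      refine ⟨x, x.2, ?_, by simpa using hx0⟩
      rw [LinearMap.mem_ker] at hx
      exact Submodule.orthogonalProjectionOnto_eq_zero_iff.mp hx
    -- The compression of `T` to the complement of the eigenvectors already found. The test vector
    -- `f` shows that its norm is at least `s`, and its top eigenvector is the next eigenvector of
    -- `T`.
    set T' : H →L[ℝ] H := Q ∘L T ∘L Q with hT'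
    have hQs : ∀ x y, inner ℝ (Q x) y = inner ℝ x (Q y) := fun x y =>
      Submodule.starProjection_isSymmetric (K := Wᗮ) x y
    have hQid : ∀ x ∈ Wᗮ, Q x = x := fun x hx => Submodule.starProjection_eq_self_iff.mpr hx
    have hQmem : ∀ x, Q x ∈ Wᗮ := fun x => Submodule.starProjection_apply_mem _ x
    have hT'c : IsCompactOperator T' := (hT.comp_clm Q).clm_comp Q
    have hT's : T'.IsSymmetric := by
      intro x y
      change inner ℝ (Q (T (Q x))) y = inner ℝ x (Q (T (Q y)))
      rw [hQs, ← hQs x]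
      exact hsymm _ _
    have hT'pos : ∀ x, 0 ≤ inner ℝ (T' x) x := by
      intro x
      change 0 ≤ inner ℝ (Q (T (Q x))) x
      rw [hQs]
      exact hpos _
    have hnorm : s ≤ ‖T'‖ := by
      have h1 : s * ‖f‖ ^ 2 ≤ ‖T'‖ * ‖f‖ ^ 2 := by
        calc s * ‖f‖ ^ 2 ≤ inner ℝ (T f) f := hV f hfV
          _ = inner ℝ (T' f) f := by
            change _ = inner ℝ (Q (T (Q f))) f
            rw [hQs, hQid f hfW]
          _ ≤ ‖T' f‖ * ‖f‖ := real_inner_le_norm _ _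
          _ ≤ (‖T'‖ * ‖f‖) * ‖f‖ := by gcongr; exact T'.le_opNorm f
          _ = ‖T'‖ * ‖f‖ ^ 2 := by ring
      exact le_of_mul_le_mul_right h1 (by positivity)
    have hT'0 : T' ≠ 0 := norm_ne_zero_iff.mp (by linarith)
    obtain ⟨e, he1, he⟩ := exists_unit_eigenvector_norm hT'c hT's hT'pos hT'0
    have hnpos : ‖T'‖ ≠ 0 := by linarith
    have heW : e ∈ Wᗮ := by
      have : e = ‖T'‖⁻¹ • T' e := by rw [he, smul_smul, inv_mul_cancel₀ hnpos, one_smul]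
      rw [this]
      exact Wᗮ.smul_mem _ (hQmem _)
    have heT : T e = ‖T'‖ • e := by
      rw [← he]
      change _ = Q (T (Q e))
      rw [hQid e heW, hQid _ (hTW e heW)]
    have horth : ∀ k, inner ℝ (φ k) e = 0 := fun k =>
      (Submodule.mem_orthogonal _ _).mp heW _ (Submodule.subset_span ⟨k, rfl⟩)
    refine ⟨Fin.snoc φ e, Fin.snoc θ ‖T'‖, ⟨fun k => ?_, fun k l hkl => ?_⟩, fun k => ?_⟩
    · refine Fin.lastCases ?_ (fun k => ?_) k
      · simpa using he1
      · simpa using hφ.1 k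
    · revert hkl
      refine Fin.lastCases ?_ (fun k => ?_) k <;> refine Fin.lastCases ?_ (fun l => ?_) l
      · intro h; exact absurd rfl h
      · intro _; simpa [real_inner_comm] using horth l
      · intro _; simpa using horth k
      · intro h
        simpa using hφ.2 (fun h' => h (by rw [h']))
    · refine Fin.lastCases ?_ (fun k => ?_) k
      · simpa using ⟨hnorm, heT⟩
      · simpa using hθ k

end Hilbert

/-! ### Square integrals in extended non-negative form. -/

section SquareIntegrals

variable {α : Type*} [MeasurableSpace α] {μ : Measure α}

lemma eLpNorm_two_sq (f : α → ℝ) :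
    eLpNorm f 2 μ ^ 2 = ∫⁻ x, ENNReal.ofReal (f x ^ 2) ∂μ := by
  rw [eLpNorm_eq_lintegral_rpow_enorm_toReal two_ne_zero ENNReal.ofNat_ne_top, ← ENNReal.rpow_two,
    ← ENNReal.rpow_mul]
  simp only [ENNReal.toReal_ofNat, one_div, isUnit_iff_ne_zero, ne_eq, OfNat.ofNat_ne_zero,
    not_false_eq_true, IsUnit.inv_mul_cancel, ENNReal.rpow_one]
  refine lintegral_congr fun x => ?_
  rw [ENNReal.rpow_two, Real.enorm_eq_ofReal_abs, ← ENNReal.ofReal_pow (abs_nonneg _), sq_abs]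

lemma memLp_two_iff_lintegral {f : α → ℝ} (hf : AEStronglyMeasurable f μ) :
    MemLp f 2 μ ↔ ∫⁻ x, ENNReal.ofReal (f x ^ 2) ∂μ < ∞ := by
  rw [← eLpNorm_two_sq]
  simp [MemLp, hf]

lemma norm_toLp_sq {f : α → ℝ} (hf : MemLp f 2 μ) :
    ‖hf.toLp f‖ ^ 2 = (∫⁻ x, ENNReal.ofReal (f x ^ 2) ∂μ).toReal := by
  rw [Lp.norm_toLp, ← ENNReal.toReal_pow, eLpNorm_two_sq]

lemma inner_toLp {f : α → ℝ} (hf : MemLp f 2 μ) (g : Lp ℝ 2 μ) :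
    inner ℝ (hf.toLp f) g = ∫ x, f x * g x ∂μ := by
  rw [L2.inner_def]
  refine integral_congr_ae ?_
  filter_upwards [hf.coeFn_toLp] with x hx
  simp [hx, mul_comm]

lemma lintegral_sq_coeFn (g : Lp ℝ 2 μ) :
    ∫⁻ x, ENNReal.ofReal (g x ^ 2) ∂μ = ENNReal.ofReal (‖g‖ ^ 2) := by
  rw [← eLpNorm_two_sq, Lp.norm_def, ENNReal.ofReal_pow ENNReal.toReal_nonneg,
    ENNReal.ofReal_toReal (Lp.eLpNorm_ne_top g)]

lemma measurable_ofReal_sq {f : α → ℝ} (hf : Measurable f) :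
    Measurable fun x => ENNReal.ofReal (f x ^ 2) := by fun_prop

end SquareIntegrals

/-! ### Integral operators with Hilbert–Schmidt kernels. -/

section KernelOperators

variable {S T : Type*} [MeasureSpace S] [MeasureSpace T]

/-- The squared Hilbert–Schmidt norm of a kernel. -/
def hsSq (K : S → T → ℝ) : ℝ≥0∞ :=
  ∫⁻ p : S × T, ENNReal.ofReal (K p.1 p.2 ^ 2)

/-- Measurable kernels of finite Hilbert–Schmidt norm. -/
structure IsHS (K : S → T → ℝ) : Prop where
  measurable : Measurable fun p : S × T => K p.1 p.2
  finite : hsSq K < ∞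

lemma IsHS.measurable_slice {K : S → T → ℝ} (hK : IsHS K) (u : S) : Measurable (K u) :=
  hK.measurable.comp measurable_prodMk_left

lemma IsHS.memLp {K : S → T → ℝ} (hK : IsHS K) :
    MemLp (fun p : S × T => K p.1 p.2) 2 volume :=
  (memLp_two_iff_lintegral hK.measurable.aestronglyMeasurable).mpr hK.finite

lemma IsHS.of_memLp {K : S → T → ℝ} (hK : Measurable fun p : S × T => K p.1 p.2)
    (h : MemLp (fun p : S × T => K p.1 p.2) 2 volume) : IsHS K :=
  ⟨hK, (memLp_two_iff_lintegral hK.aestronglyMeasurable).mp h⟩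

lemma IsHS.sub {K L : S → T → ℝ} (hK : IsHS K) (hL : IsHS L) : IsHS (fun u v => K u v - L u v) :=
  .of_memLp (hK.measurable.sub hL.measurable) (hK.memLp.sub hL.memLp)

lemma IsHS.add {K L : S → T → ℝ} (hK : IsHS K) (hL : IsHS L) : IsHS (fun u v => K u v + L u v) :=
  .of_memLp (hK.measurable.add hL.measurable) (hK.memLp.add hL.memLp)

variable [SFinite (volume : Measure T)]

lemma hsSq_eq_lintegral {K : S → T → ℝ} (hK : Measurable fun p : S × T => K p.1 p.2) :
    hsSq K = ∫⁻ u : S, ∫⁻ v : T, ENNReal.ofReal (K u v ^ 2) :=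
  lintegral_prod _ (measurable_ofReal_sq hK).aemeasurable

/-- The value of the integral operator with kernel `K`, as a function. -/
def kernelFun (K : S → T → ℝ) (g : Lp ℝ 2 (volume : Measure T)) (u : S) : ℝ :=
  ∫ v : T, K u v * g v

lemma IsHS.stronglyMeasurable_kernelFun {K : S → T → ℝ} (hK : IsHS K)
    (g : Lp ℝ 2 (volume : Measure T)) : StronglyMeasurable (kernelFun K g) := by
  have h : StronglyMeasurable fun p : S × T => K p.1 p.2 * g p.2 :=
    hK.measurable.stronglyMeasurable.mul
      ((Lp.stronglyMeasurable g).comp_measurable measurable_snd)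
  exact h.integral_prod_right'

lemma IsHS.ae_memLp {K : S → T → ℝ} (hK : IsHS K) : ∀ᵐ u : S, MemLp (K u) 2 volume := by
  have h1 : ∫⁻ u : S, ∫⁻ v : T, ENNReal.ofReal (K u v ^ 2) ≠ ∞ := by
    rw [← hsSq_eq_lintegral hK.measurable]; exact hK.finite.ne
  have h2 : Measurable fun u : S => ∫⁻ v : T, ENNReal.ofReal (K u v ^ 2) :=
    (measurable_ofReal_sq hK.measurable).lintegral_prod_right'
  filter_upwards [ae_lt_top h2 h1] with u hu
  exact (memLp_two_iff_lintegral (hK.measurable_slice u).aestronglyMeasurable).mpr hu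

/-- Hölder on the product space, where `f ⊗ g` is square integrable. This licenses every use of
Fubini's theorem below. -/
lemma integrable_kernel_mul {K : S → T → ℝ} (hK : IsHS K) (f : Lp ℝ 2 (volume : Measure S))
    (g : Lp ℝ 2 (volume : Measure T)) :
    Integrable (fun p : S × T => K p.1 p.2 * (f p.1 * g p.2)) volume := by
  refine hK.memLp.integrable_mul (q := 2) ?_
  have hmeas : StronglyMeasurable fun p : S × T => f p.1 * g p.2 :=
    ((Lp.stronglyMeasurable f).comp_measurable measurable_fst).mul
      ((Lp.stronglyMeasurable g).comp_measurable measurable_snd)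
  rw [memLp_two_iff_lintegral hmeas.aestronglyMeasurable]
  have h : ∀ p : S × T, ENNReal.ofReal ((f p.1 * g p.2) ^ 2)
      = ENNReal.ofReal (f p.1 ^ 2) * ENNReal.ofReal (g p.2 ^ 2) := fun p => by
    rw [mul_pow, ENNReal.ofReal_mul (sq_nonneg _)]
  simp_rw [h]
  rw [Measure.volume_eq_prod, lintegral_prod_mul
    (measurable_ofReal_sq (Lp.stronglyMeasurable f).measurable).aemeasurable
    (measurable_ofReal_sq (Lp.stronglyMeasurable g).measurable).aemeasurable,
    lintegral_sq_coeFn, lintegral_sq_coeFn]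
  exact ENNReal.mul_lt_top ENNReal.ofReal_lt_top ENNReal.ofReal_lt_top

/-- Cauchy–Schwarz in the second variable for almost every `u`, then integration over `u`. -/
lemma IsHS.lintegral_kernelFun_sq_le {K : S → T → ℝ} (hK : IsHS K)
    (g : Lp ℝ 2 (volume : Measure T)) :
    ∫⁻ u : S, ENNReal.ofReal (kernelFun K g u ^ 2) ≤ hsSq K * ENNReal.ofReal (‖g‖ ^ 2) := by
  rw [hsSq_eq_lintegral hK.measurable, ← lintegral_mul_const']
  · refine lintegral_mono_ae ?_
    filter_upwards [hK.ae_memLp] with u hu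
    have h1 : kernelFun K g u = inner ℝ (hu.toLp (K u)) g := (inner_toLp hu g).symm
    have h2 : kernelFun K g u ^ 2 ≤ ‖hu.toLp (K u)‖ ^ 2 * ‖g‖ ^ 2 := by
      rw [h1, ← mul_pow, ← sq_abs]
      gcongr
      exact abs_real_inner_le_norm _ _
    calc ENNReal.ofReal (kernelFun K g u ^ 2)
        ≤ ENNReal.ofReal (‖hu.toLp (K u)‖ ^ 2 * ‖g‖ ^ 2) := ENNReal.ofReal_le_ofReal h2
      _ = _ := by
        rw [ENNReal.ofReal_mul (sq_nonneg _), norm_toLp_sq, ENNReal.ofReal_toReal]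
        exact ((memLp_two_iff_lintegral hu.1).mp hu).ne
  · exact ENNReal.ofReal_ne_top

lemma IsHS.memLp_kernelFun {K : S → T → ℝ} (hK : IsHS K) (g : Lp ℝ 2 (volume : Measure T)) :
    MemLp (kernelFun K g) 2 volume := by
  rw [memLp_two_iff_lintegral (hK.stronglyMeasurable_kernelFun g).aestronglyMeasurable]
  exact (hK.lintegral_kernelFun_sq_le g).trans_lt
    (ENNReal.mul_lt_top hK.finite ENNReal.ofReal_lt_top)

/-- The integral operator `L²(T) → L²(S)` with Hilbert–Schmidt kernel `K`. -/
def kernelOp {K : S → T → ℝ} (hK : IsHS K) :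
    Lp ℝ 2 (volume : Measure T) →L[ℝ] Lp ℝ 2 (volume : Measure S) :=
  LinearMap.mkContinuous
    { toFun := fun g => (hK.memLp_kernelFun g).toLp _
      map_add' := by
        intro g h
        rw [← MemLp.toLp_add]
        refine MemLp.toLp_congr _ _ ?_
        filter_upwards [hK.ae_memLp] with u hu
        simp only [kernelFun, Pi.add_apply]
        rw [← inner_toLp hu, ← inner_toLp hu, ← inner_toLp hu, inner_add_right]
      map_smul' := by
        intro c g
        rw [RingHom.id_apply, ← MemLp.toLp_const_smul]
        refine MemLp.toLp_congr _ _ ?_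
        filter_upwards [hK.ae_memLp] with u hu
        simp only [kernelFun, Pi.smul_apply, smul_eq_mul]
        rw [← inner_toLp hu, ← inner_toLp hu, inner_smul_right] }
    (Real.sqrt (hsSq K).toReal) (by
      intro g
      change ‖(hK.memLp_kernelFun g).toLp _‖ ≤ _
      refine le_of_sq_le_sq ?_ (by positivity)
      rw [mul_pow, Real.sq_sqrt ENNReal.toReal_nonneg, norm_toLp_sq]
      refine (ENNReal.toReal_mono ?_ (hK.lintegral_kernelFun_sq_le g)).trans_eq ?_
      · exact ENNReal.mul_ne_top hK.finite.ne ENNReal.ofReal_ne_top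
      · rw [ENNReal.toReal_mul, ENNReal.toReal_ofReal (sq_nonneg _)])

lemma norm_kernelOp_le {K : S → T → ℝ} (hK : IsHS K) :
    ‖kernelOp hK‖ ≤ Real.sqrt (hsSq K).toReal :=
  LinearMap.mkContinuous_norm_le _ (Real.sqrt_nonneg _) _

lemma coeFn_kernelOp {K : S → T → ℝ} (hK : IsHS K) (g : Lp ℝ 2 (volume : Measure T)) :
    kernelOp hK g =ᵐ[volume] kernelFun K g :=
  (hK.memLp_kernelFun g).coeFn_toLp

lemma kernelOp_sub {K L : S → T → ℝ} (hK : IsHS K) (hL : IsHS L) :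
    kernelOp (hK.sub hL) = kernelOp hK - kernelOp hL := by
  refine ContinuousLinearMap.ext fun g => Lp.ext ?_
  rw [sub_apply]
  filter_upwards [coeFn_kernelOp (hK.sub hL) g, coeFn_kernelOp hK g, coeFn_kernelOp hL g,
    Lp.coeFn_sub (kernelOp hK g) (kernelOp hL g), hK.ae_memLp, hL.ae_memLp]
    with u h1 h2 h3 h4 h5 h6
  rw [h1, h4, Pi.sub_apply, h2, h3, kernelFun, kernelFun, kernelFun, ← integral_sub]
  · simp only [sub_mul]
  · exact h5.integrable_mul (Lp.memLp g)
  · exact h6.integrable_mul (Lp.memLp g)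

variable [SFinite (volume : Measure S)]

lemma hsSq_swap (K : S → T → ℝ) :
    hsSq (fun v u => K u v) = hsSq K := by
  have := lintegral_prod_swap (μ := (volume : Measure S)) (ν := (volume : Measure T))
    (fun p : S × T => ENNReal.ofReal (K p.1 p.2 ^ 2))
  exact this

lemma IsHS.swap {K : S → T → ℝ} (hK : IsHS K) : IsHS (fun v u => K u v) :=
  ⟨hK.measurable.comp measurable_swap, by rw [hsSq_swap]; exact hK.finite⟩

/-- The adjoint of an integral operator has the transposed kernel. -/
lemma inner_kernelOp_left {K : S → T → ℝ} (hK : IsHS K) (g : Lp ℝ 2 (volume : Measure T))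
    (f : Lp ℝ 2 (volume : Measure S)) :
    inner ℝ (kernelOp hK g) f = inner ℝ g (kernelOp hK.swap f) := by
  have hint := integrable_kernel_mul hK f g
  rw [Measure.volume_eq_prod] at hint
  rw [real_inner_comm (kernelOp hK.swap f) g]
  change inner ℝ ((hK.memLp_kernelFun g).toLp _) f = inner ℝ ((hK.swap.memLp_kernelFun f).toLp _) g
  rw [inner_toLp, inner_toLp]
  calc ∫ u : S, kernelFun K g u * f u
      = ∫ u : S, ∫ v : T, K u v * (f u * g v) := by
        refine integral_congr_ae (.of_forall fun u => ?_)
        simp only [kernelFun]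
        rw [← integral_mul_const]
        exact integral_congr_ae (.of_forall fun v => by ring)
    _ = ∫ v : T, ∫ u : S, K u v * (f u * g v) := integral_integral_swap hint
    _ = ∫ v : T, kernelFun (fun v u => K u v) f v * g v := by
        refine integral_congr_ae (.of_forall fun v => ?_)
        simp only [kernelFun]
        rw [← integral_mul_const]
        exact integral_congr_ae (.of_forall fun u => by ring)

/-- The operator `K K*`. -/
def squareOp {K : S → T → ℝ} (hK : IsHS K) :
    Lp ℝ 2 (volume : Measure S) →L[ℝ] Lp ℝ 2 (volume : Measure S) :=
  kernelOp hK ∘L kernelOp hK.swap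

lemma inner_squareOp {K : S → T → ℝ} (hK : IsHS K) (f g : Lp ℝ 2 (volume : Measure S)) :
    inner ℝ (squareOp hK f) g = inner ℝ (kernelOp hK.swap f) (kernelOp hK.swap g) :=
  inner_kernelOp_left hK _ _

lemma squareOp_isSymmetric {K : S → T → ℝ} (hK : IsHS K) : (squareOp hK).IsSymmetric := by
  intro f g
  change inner ℝ (squareOp hK f) g = inner ℝ f (squareOp hK g)
  rw [inner_squareOp, real_inner_comm _ f, inner_squareOp, real_inner_comm]

lemma inner_squareOp_self {K : S → T → ℝ} (hK : IsHS K) (f : Lp ℝ 2 (volume : Measure S)) :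
    inner ℝ (squareOp hK f) f = ‖kernelOp hK.swap f‖ ^ 2 := by
  rw [inner_squareOp, real_inner_self_eq_norm_sq]

/-- The bridge between the pointwise definition of the spectral values and operator theory: by
Fubini, integrating against the square kernel is applying `K K*`. -/
lemma isEigenfunction_squareKernel_iff {K : S → T → ℝ} (hK : IsHS K) (θ : ℝ)
    (f : Lp ℝ 2 (volume : Measure S)) :
    IsEigenfunction (squareKernel K) θ f ↔ squareOp hK f = θ • f := by
  have key : ∀ᵐ u : S, ∫ z : S, squareKernel K u z * f z = squareOp hK f u := by
    filter_upwards [coeFn_kernelOp hK (kernelOp hK.swap f), hK.ae_memLp] with u h1 hu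
    change _ = kernelOp hK (kernelOp hK.swap f) u
    rw [h1, kernelFun]
    -- For almost every `u` the section `K u` is itself an `L²` function, so it can serve as the
    -- second test function.
    have hint := integrable_kernel_mul hK f (hu.toLp (K u))
    rw [Measure.volume_eq_prod] at hint
    calc ∫ z : S, squareKernel K u z * f z
        = ∫ z : S, ∫ v : T, K z v * (f z * hu.toLp (K u) v) := by
          refine integral_congr_ae (.of_forall fun z => ?_)
          simp only [squareKernel]
          rw [← integral_mul_const]
          refine integral_congr_ae ?_
          filter_upwards [hu.coeFn_toLp] with v hv
          rw [hv]; ring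
      _ = ∫ v : T, ∫ z : S, K z v * (f z * hu.toLp (K u) v) := integral_integral_swap hint
      _ = ∫ v : T, K u v * kernelOp hK.swap f v := by
          refine integral_congr_ae ?_
          filter_upwards [hu.coeFn_toLp, coeFn_kernelOp hK.swap f] with v hv hv'
          rw [hv', hv, kernelFun, ← integral_const_mul]
          exact integral_congr_ae (.of_forall fun z => by ring)
  unfold IsEigenfunction
  constructor
  · intro h
    refine Lp.ext ?_
    filter_upwards [h, key, Lp.coeFn_smul θ f] with u h1 h2 h3
    rw [h3, ← h2, h1]; rfl
  · intro h
    filter_upwards [key, Lp.coeFn_smul θ f] with u h2 h3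
    rw [h2, h, h3]; rfl

end KernelOperators

/-! ### Compactness of kernel operators and Weyl's inequality. -/

section Weyl

variable {S T : Type*} [MeasureSpace S] [MeasureSpace T]

/-- The numbers `t > 0` for which the operator `K K*` has `j` orthonormal eigenvectors with
eigenvalues at least `t`. -/
def eigenLevels (K : S → T → ℝ) (j : ℕ) : Set ℝ :=
  {t : ℝ | 0 < t ∧ ∃ (φ : Fin j → Lp ℝ 2 (volume : Measure S)) (θ : Fin j → ℝ),
    Orthonormal ℝ φ ∧ ∀ i, t ≤ θ i ∧ IsEigenfunction (squareKernel K) (θ i) (φ i)}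

lemma lam_nonneg (K : S → T → ℝ) (j : ℕ) : 0 ≤ lam K j :=
  Real.sSup_nonneg fun _ ht => ht.1.le

variable [SFinite (volume : Measure T)]

lemma hsSq_mul {a : S → ℝ} {b : T → ℝ} (ha : Measurable a) (hb : Measurable b) :
    hsSq (fun u v => a u * b v)
      = (∫⁻ u, ENNReal.ofReal (a u ^ 2)) * ∫⁻ v, ENNReal.ofReal (b v ^ 2) := by
  unfold hsSq
  simp_rw [mul_pow, ENNReal.ofReal_mul (sq_nonneg _)]
  rw [Measure.volume_eq_prod, lintegral_prod_mul
    (measurable_ofReal_sq ha).aemeasurable (measurable_ofReal_sq hb).aemeasurable]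

lemma isHS_mul {a : S → ℝ} {b : T → ℝ} (ha : Measurable a) (hb : Measurable b)
    (ha2 : MemLp a 2 volume) (hb2 : MemLp b 2 volume) : IsHS (fun u v => a u * b v) := by
  refine ⟨by fun_prop, ?_⟩
  rw [hsSq_mul ha hb]
  exact ENNReal.mul_lt_top ((memLp_two_iff_lintegral ha2.1).mp ha2)
    ((memLp_two_iff_lintegral hb2.1).mp hb2)

lemma kernelOp_add {K L : S → T → ℝ} (hK : IsHS K) (hL : IsHS L) :
    kernelOp (hK.add hL) = kernelOp hK + kernelOp hL := by
  refine ContinuousLinearMap.ext fun g => Lp.ext ?_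
  rw [add_apply]
  filter_upwards [coeFn_kernelOp (hK.add hL) g, coeFn_kernelOp hK g, coeFn_kernelOp hL g,
    Lp.coeFn_add (kernelOp hK g) (kernelOp hL g), hK.ae_memLp, hL.ae_memLp]
    with u h1 h2 h3 h4 h5 h6
  rw [h1, h4, Pi.add_apply, h2, h3, kernelFun, kernelFun, kernelFun, ← integral_add]
  · simp only [add_mul]
  · exact h5.integrable_mul (Lp.memLp g)
  · exact h6.integrable_mul (Lp.memLp g)

/-- A rank-one operator factors through `ℝ`, where closed balls are compact. -/
lemma isCompactOperator_smulRight {E F : Type*} [NormedAddCommGroup E] [NormedSpace ℝ E]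
    [NormedAddCommGroup F] [NormedSpace ℝ F] (l : E →L[ℝ] ℝ) (a : F) :
    IsCompactOperator (l.smulRight a) := by
  have hid : IsCompactOperator (id : ℝ → ℝ) :=
    ⟨Metric.closedBall 0 1, isCompact_closedBall 0 1, by
      simpa using Metric.closedBall_mem_nhds (0 : ℝ) one_pos⟩
  have h1 : IsCompactOperator (id ∘ l) := hid.comp_clm l
  exact h1.clm_comp (ContinuousLinearMap.toSpanSingleton ℝ a)

lemma isCompactOperator_kernelOp_mul {a : S → ℝ} {b : T → ℝ}
    (ha2 : MemLp a 2 volume) (hb2 : MemLp b 2 volume) (h : IsHS fun u v => a u * b v) :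
    IsCompactOperator (kernelOp h) := by
  have heq : kernelOp h
      = (innerSL ℝ (hb2.toLp b)).smulRight (ha2.toLp a) := by
    refine ContinuousLinearMap.ext fun g => Lp.ext ?_
    rw [ContinuousLinearMap.smulRight_apply, innerSL_apply_apply]
    filter_upwards [coeFn_kernelOp h g, ha2.coeFn_toLp,
      Lp.coeFn_smul (inner ℝ (hb2.toLp b) g) (ha2.toLp a)] with u h1 h2 h3
    rw [h1, h3, Pi.smul_apply, h2, inner_toLp, kernelFun, smul_eq_mul, ← integral_mul_const]
    exact integral_congr_ae (.of_forall fun v => by ring)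
  rw [heq]
  exact isCompactOperator_smulRight _ _

/-- Degenerate kernels give compact operators. -/
lemma isHS_sum_mul {ι : Type*} (s : Finset ι) {a : ι → S → ℝ} {b : ι → T → ℝ}
    (ha : ∀ i, Measurable (a i)) (hb : ∀ i, Measurable (b i))
    (ha2 : ∀ i ∈ s, MemLp (a i) 2 volume) (hb2 : ∀ i ∈ s, MemLp (b i) 2 volume) :
    ∃ h : IsHS (fun u v => ∑ i ∈ s, a i u * b i v), IsCompactOperator (kernelOp h) := by
  classical
  induction s using Finset.induction_on with
  | empty =>
    simp only [Finset.sum_empty]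
    have h0 : IsHS (fun (_ : S) (_ : T) => (0 : ℝ)) := ⟨measurable_const, by simp [hsSq]⟩
    refine ⟨h0, ?_⟩
    have : kernelOp h0 = 0 := by
      refine ContinuousLinearMap.ext fun g => Lp.ext ?_
      rw [zero_apply]
      filter_upwards [coeFn_kernelOp h0 g, Lp.coeFn_zero ℝ 2 (volume : Measure S)] with u h1 h2
      rw [h1, h2]
      simp [kernelFun]
    rw [this]
    exact isCompactOperator_zero
  | insert i s hi ih =>
    obtain ⟨h, hc⟩ := ih (fun k hk => ha2 k (Finset.mem_insert_of_mem hk))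
      (fun k hk => hb2 k (Finset.mem_insert_of_mem hk))
    have ha2i := ha2 i (Finset.mem_insert_self i s)
    have hb2i := hb2 i (Finset.mem_insert_self i s)
    have hi' := isHS_mul (ha i) (hb i) ha2i hb2i
    simp only [Finset.sum_insert hi]
    refine ⟨hi'.add h, ?_⟩
    rw [kernelOp_add hi' h]
    exact (isCompactOperator_kernelOp_mul ha2i hb2i hi').add hc

/-- A Hilbert–Schmidt kernel that is approximated by kernels of compact operators gives a compact
operator. -/
lemma isCompactOperator_kernelOp_of_forall {L : S → T → ℝ} (hL : IsHS L)
    (h : ∀ ε : ℝ, 0 < ε → ∃ (K : S → T → ℝ) (hK : IsHS K), IsCompactOperator (kernelOp hK) ∧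
      Real.sqrt (hsSq fun u v => K u v - L u v).toReal ≤ ε) :
    IsCompactOperator (kernelOp hL) := by
  choose K hK hc hε using fun n : ℕ => h (1 / ((n : ℝ) + 1)) (by positivity)
  refine isCompactOperator_of_tendsto (l := atTop) (F := fun n => kernelOp (hK n)) ?_
    (.of_forall hc)
  rw [tendsto_iff_norm_sub_tendsto_zero]
  refine squeeze_zero (fun n => norm_nonneg _) (fun n => ?_)
    tendsto_one_div_add_atTop_nhds_zero_nat
  rw [← kernelOp_sub]
  exact (norm_kernelOp_le _).trans (hε n)

variable [SFinite (volume : Measure S)]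

/-- No eigenvalue exceeds the operator norm. For `j = 0` the family of eigenfunctions is empty and
every positive number is a level, hence `1 ≤ j`. -/
lemma bddAbove_eigenLevels {K : S → T → ℝ} (hK : IsHS K) {j : ℕ} (hj : 1 ≤ j) :
    BddAbove (eigenLevels K j) := by
  refine ⟨‖squareOp hK‖, fun t ⟨_, φ, θ, hφ, hθ⟩ => ?_⟩
  have i : Fin j := ⟨0, hj⟩
  refine (hθ i).1.trans ((le_abs_self _).trans ?_)
  have h1 := (squareOp hK).le_opNorm (φ i)
  rwa [(isEigenfunction_squareKernel_iff hK _ _).mp (hθ i).2, norm_smul, hφ.1 i, mul_one, mul_one]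
    at h1

lemma norm_sq_sum_smul_orthonormal {H : Type*} [NormedAddCommGroup H] [InnerProductSpace ℝ H]
    {ι : Type*} [Fintype ι] {φ : ι → H} (hφ : Orthonormal ℝ φ) (c : ι → ℝ) :
    ‖∑ i, c i • φ i‖ ^ 2 = ∑ i, c i ^ 2 := by
  rw [← real_inner_self_eq_norm_sq, hφ.inner_sum]
  simp [sq]

/-- On the span of orthonormal eigenvectors of `K K*` with eigenvalues at least `t`,
`‖K* f‖ ≥ √t ‖f‖`. -/
lemma sqrt_mul_norm_le_of_mem_span {K : S → T → ℝ} (hK : IsHS K) {j : ℕ} {t : ℝ} (ht : 0 < t)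
    {φ : Fin j → Lp ℝ 2 (volume : Measure S)} {θ : Fin j → ℝ} (hφ : Orthonormal ℝ φ)
    (hθ : ∀ i, t ≤ θ i ∧ IsEigenfunction (squareKernel K) (θ i) (φ i))
    {f : Lp ℝ 2 (volume : Measure S)} (hf : f ∈ Submodule.span ℝ (Set.range φ)) :
    Real.sqrt t * ‖f‖ ≤ ‖kernelOp hK.swap f‖ := by
  obtain ⟨c, rfl⟩ := (Submodule.mem_span_range_iff_exists_fun ℝ).mp hf
  refine le_of_sq_le_sq ?_ (norm_nonneg _)
  rw [mul_pow, Real.sq_sqrt ht.le, ← inner_squareOp_self hK, map_sum,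
    norm_sq_sum_smul_orthonormal hφ]
  have h1 : ∀ i, squareOp hK (c i • φ i) = (c i * θ i) • φ i := fun i => by
    rw [map_smul, (isEigenfunction_squareKernel_iff hK _ _).mp (hθ i).2, smul_smul]
  simp_rw [h1]
  rw [hφ.inner_sum, Finset.mul_sum]
  refine Finset.sum_le_sum fun i _ => ?_
  simp only [conj_trivial]
  nlinarith [sq_nonneg (c i), (hθ i).1]

/-- Weyl's inequality for singular values. -/
lemma sqrt_lam_le_add {K L : S → T → ℝ} (hK : IsHS K) (hL : IsHS L)
    (hLc : IsCompactOperator (kernelOp hL)) {j : ℕ} (hj : 1 ≤ j) :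
    Real.sqrt (lam K j) ≤
      Real.sqrt (lam L j) + Real.sqrt (hsSq fun u v => K u v - L u v).toReal := by
  set ε := Real.sqrt (hsSq fun u v => K u v - L u v).toReal with hε
  have hε0 : 0 ≤ ε := Real.sqrt_nonneg _
  refine Real.sqrt_le_left (by positivity) |>.mpr ?_
  refine Real.sSup_le (fun t ht => ?_) (sq_nonneg _)
  rw [← Real.sqrt_le_left (by positivity)]
  obtain ⟨ht0, φ, θ, hφ, hθ⟩ := ht
  rcases le_or_gt (Real.sqrt t) ε with h | h
  · linarith [Real.sqrt_nonneg (lam L j)]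
  have hs : 0 < (Real.sqrt t - ε) ^ 2 := by have := sub_pos.mpr h; positivity
  -- The span of the eigenvectors of `K K*` is the test space for `L L*`: on it `‖L* f‖ ≥ ‖K* f‖ - ε
  -- ‖f‖ ≥ (√t - ε) ‖f‖`.
  have hmem : (Real.sqrt t - ε) ^ 2 ∈ eigenLevels L j := by
    refine ⟨hs, ?_⟩
    have hcomp : IsCompactOperator (squareOp hL) := hLc.comp_clm (kernelOp hL.swap)
    obtain ⟨φ', θ', hφ', hθ'⟩ := exists_orthonormal_eigenvectors hcomp (squareOp_isSymmetric hL)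
      (fun f => by rw [inner_squareOp_self]; positivity) hφ.linearIndependent hs
      (fun f hf => by
        rw [inner_squareOp_self, ← mul_pow]
        have h1 := sqrt_mul_norm_le_of_mem_span hK ht0 hφ hθ hf
        have h2 : ‖kernelOp hK.swap f - kernelOp hL.swap f‖ ≤ ε * ‖f‖ := by
          rw [← sub_apply, ← kernelOp_sub hK.swap hL.swap]
          refine (ContinuousLinearMap.le_opNorm _ _).trans ?_
          gcongr
          refine (norm_kernelOp_le _).trans_eq ?_
          rw [hε, ← hsSq_swap]
        have h3 := norm_sub_norm_le (kernelOp hK.swap f) (kernelOp hL.swap f)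
        have h4 : (Real.sqrt t - ε) * ‖f‖ ≤ ‖kernelOp hL.swap f‖ := by linarith
        have h5 := sub_pos.mpr h
        gcongr)
    exact ⟨φ', θ', hφ', fun i => ⟨(hθ' i).1,
      (isEigenfunction_squareKernel_iff hL _ _).mpr (hθ' i).2⟩⟩
  have h1 : (Real.sqrt t - ε) ^ 2 ≤ lam L j := le_csSup (bddAbove_eigenLevels hL hj) hmem
  have h2 := Real.le_sqrt_of_sq_le h1
  linarith

end Weyl

/-! ### From relative dependence of events to covariances of functions. -/

section RelativeDependence

/-- After trimming to the smaller σ-algebra the hypothesis is an inequality of measures. -/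
lemma lintegral_le_of_forall_measurableSet {Ω : Type*} {m m0 : MeasurableSpace Ω} (hm : m ≤ m0)
    {ν₁ ν₂ : Measure Ω} (h : ∀ A, MeasurableSet[m] A → ν₁ A ≤ ν₂ A) {f : Ω → ℝ≥0∞}
    (hf : Measurable[m] f) : ∫⁻ ω, f ω ∂ν₁ ≤ ∫⁻ ω, f ω ∂ν₂ := by
  rw [← lintegral_trim hm hf, ← lintegral_trim hm hf]
  refine lintegral_mono' (Measure.le_iff.mpr fun A hA => ?_) le_rfl
  rw [trim_measurableSet_eq hm hA, trim_measurableSet_eq hm hA]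
  exact h A hA

variable {Ω : Type*} {m₁ m₂ : MeasurableSpace Ω} [m0 : MeasurableSpace Ω]

variable {P : Measure Ω} {c : ℝ≥0∞}

/-- One factor is extended from indicators to functions at a time: first `g`, with `A` fixed and `P`
restricted to it, then `f`, under the measure with density `g`. -/
lemma lintegral_mul_le_of_forall_inter_le (hm₁ : m₁ ≤ m0) (hm₂ : m₂ ≤ m0)
    (h : ∀ A B, MeasurableSet[m₁] A → MeasurableSet[m₂] B →
      P (A ∩ B) ≤ (1 + c) * (P A * P B))
    {f g : Ω → ℝ≥0∞} (hf : Measurable[m₁] f) (hg : Measurable[m₂] g) :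
    ∫⁻ ω, f ω * g ω ∂P ≤ (1 + c) * ((∫⁻ ω, f ω ∂P) * ∫⁻ ω, g ω ∂P) := by
  have step1 : ∀ A, MeasurableSet[m₁] A →
      ∫⁻ ω in A, g ω ∂P ≤ (1 + c) * (P A * ∫⁻ ω, g ω ∂P) := by
    intro A hA
    have := lintegral_le_of_forall_measurableSet hm₂ (ν₁ := P.restrict A)
      (ν₂ := ((1 + c) * P A) • P) (fun B hB => by
        rw [Measure.restrict_apply (hm₂ B hB), Set.inter_comm, Measure.smul_apply, smul_eq_mul,
          mul_assoc]
        exact h A B hA hB) hg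
    rwa [lintegral_smul_measure, smul_eq_mul, mul_assoc] at this
  have step2 := lintegral_le_of_forall_measurableSet hm₁ (ν₁ := P.withDensity g)
    (ν₂ := ((1 + c) * ∫⁻ ω, g ω ∂P) • P) (fun A hA => by
      rw [withDensity_apply _ (hm₁ A hA), Measure.smul_apply, smul_eq_mul, mul_assoc,
        mul_comm (lintegral P g)]
      exact step1 A hA) hf
  rw [lintegral_smul_measure, smul_eq_mul, mul_assoc, mul_comm (lintegral P g),
    lintegral_withDensity_eq_lintegral_mul _ (hg.mono hm₂ le_rfl) (hf.mono hm₁ le_rfl)] at step2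
  simpa [mul_comm] using step2

/-- The matching lower bound by the same two steps. It is stated additively because subtraction in
`ℝ≥0∞` truncates. -/
lemma lintegral_mul_lintegral_le_of_forall_le_inter (hm₁ : m₁ ≤ m0) (hm₂ : m₂ ≤ m0)
    (h : ∀ A B, MeasurableSet[m₁] A → MeasurableSet[m₂] B →
      P A * P B ≤ P (A ∩ B) + c * (P A * P B))
    {f g : Ω → ℝ≥0∞} (hf : Measurable[m₁] f) (hg : Measurable[m₂] g) :
    (∫⁻ ω, f ω ∂P) * ∫⁻ ω, g ω ∂P ≤
      ∫⁻ ω, f ω * g ω ∂P + c * ((∫⁻ ω, f ω ∂P) * ∫⁻ ω, g ω ∂P) := by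
  have step1 : ∀ A, MeasurableSet[m₁] A →
      P A * ∫⁻ ω, g ω ∂P ≤ ∫⁻ ω in A, g ω ∂P + c * (P A * ∫⁻ ω, g ω ∂P) := by
    intro A hA
    have := lintegral_le_of_forall_measurableSet hm₂ (ν₁ := (P A) • P)
      (ν₂ := P.restrict A + (c * P A) • P) (fun B hB => by
        rw [Measure.add_apply, Measure.restrict_apply (hm₂ B hB), Set.inter_comm,
          Measure.smul_apply, Measure.smul_apply, smul_eq_mul, smul_eq_mul, mul_assoc]
        exact h A B hA hB) hg
    rwa [lintegral_add_measure, lintegral_smul_measure, lintegral_smul_measure, smul_eq_mul,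
      smul_eq_mul, mul_assoc] at this
  have step2 := lintegral_le_of_forall_measurableSet hm₁ (ν₁ := (∫⁻ ω, g ω ∂P) • P)
    (ν₂ := P.withDensity g + (c * ∫⁻ ω, g ω ∂P) • P) (fun A hA => by
      rw [Measure.add_apply, withDensity_apply _ (hm₁ A hA), Measure.smul_apply,
        Measure.smul_apply, smul_eq_mul, smul_eq_mul, mul_assoc, mul_comm (lintegral P g)]
      exact step1 A hA) hf
  rw [lintegral_add_measure, lintegral_smul_measure, lintegral_smul_measure, smul_eq_mul,
    smul_eq_mul, mul_assoc, mul_comm (lintegral P g),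
    lintegral_withDensity_eq_lintegral_mul _ (hg.mono hm₂ le_rfl) (hf.mono hm₁ le_rfl)] at step2
  simpa [mul_comm] using step2

lemma abs_integral_mul_sub_le_of_nonneg (hm₁ : m₁ ≤ m0) (hm₂ : m₂ ≤ m0) (hc : c ≠ ∞)
    (h1 : ∀ A B, MeasurableSet[m₁] A → MeasurableSet[m₂] B →
      P (A ∩ B) ≤ (1 + c) * (P A * P B))
    (h2 : ∀ A B, MeasurableSet[m₁] A → MeasurableSet[m₂] B →
      P A * P B ≤ P (A ∩ B) + c * (P A * P B))
    {f g : Ω → ℝ} (hf : Measurable[m₁] f) (hg : Measurable[m₂] g)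
    (hf0 : 0 ≤ f) (hg0 : 0 ≤ g) (hfi : Integrable f P) (hgi : Integrable g P)
    (hfg : Integrable (fun ω => f ω * g ω) P) :
    |∫ ω, f ω * g ω ∂P - (∫ ω, f ω ∂P) * ∫ ω, g ω ∂P| ≤
      c.toReal * ((∫ ω, f ω ∂P) * ∫ ω, g ω ∂P) := by
  have hF : Measurable[m₁] fun ω => ENNReal.ofReal (f ω) := ENNReal.measurable_ofReal.comp hf
  have hG : Measurable[m₂] fun ω => ENNReal.ofReal (g ω) := ENNReal.measurable_ofReal.comp hg
  have e1 := ofReal_integral_eq_lintegral_ofReal hfi (.of_forall hf0)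
  have e2 := ofReal_integral_eq_lintegral_ofReal hgi (.of_forall hg0)
  have e3 := ofReal_integral_eq_lintegral_ofReal hfg
    (.of_forall fun ω => mul_nonneg (hf0 ω) (hg0 ω))
  simp_rw [ENNReal.ofReal_mul (hf0 _)] at e3
  have i1 : 0 ≤ ∫ ω, f ω ∂P := integral_nonneg hf0
  have i2 : 0 ≤ ∫ ω, g ω ∂P := integral_nonneg hg0
  have i3 : 0 ≤ ∫ ω, f ω * g ω ∂P := integral_nonneg fun ω => mul_nonneg (hf0 ω) (hg0 ω)
  have k1 := lintegral_mul_le_of_forall_inter_le hm₁ hm₂ h1 hF hG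
  have k2 := lintegral_mul_lintegral_le_of_forall_le_inter hm₁ hm₂ h2 hF hG
  have hc' : ENNReal.ofReal c.toReal = c := ENNReal.ofReal_toReal hc
  have hc0 : 0 ≤ c.toReal := ENNReal.toReal_nonneg
  rw [← e1, ← e2, ← e3, ← hc', ← ENNReal.ofReal_mul i1, ← ENNReal.ofReal_one,
    ← ENNReal.ofReal_add zero_le_one hc0, ← ENNReal.ofReal_mul (by positivity),
    ENNReal.ofReal_le_ofReal_iff (by positivity)] at k1
  rw [← e1, ← e2, ← e3, ← hc', ← ENNReal.ofReal_mul i1, ← ENNReal.ofReal_mul hc0,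
    ← ENNReal.ofReal_add i3 (by positivity), ENNReal.ofReal_le_ofReal_iff (by positivity)] at k2
  rw [abs_le]
  constructor <;> linarith

/-- Both functions are split into positive and negative parts. The four error bounds add up to
exactly `c E|f| E|g|`, so the splitting costs no constant. -/
lemma abs_integral_mul_sub_le (hm₁ : m₁ ≤ m0) (hm₂ : m₂ ≤ m0) (hc : c ≠ ∞) [IsFiniteMeasure P]
    (h1 : ∀ A B, MeasurableSet[m₁] A → MeasurableSet[m₂] B →
      P (A ∩ B) ≤ (1 + c) * (P A * P B))
    (h2 : ∀ A B, MeasurableSet[m₁] A → MeasurableSet[m₂] B →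
      P A * P B ≤ P (A ∩ B) + c * (P A * P B))
    {f g : Ω → ℝ} (hf : Measurable[m₁] f) (hg : Measurable[m₂] g)
    (hf2 : MemLp f 2 P) (hg2 : MemLp g 2 P) :
    |∫ ω, f ω * g ω ∂P - (∫ ω, f ω ∂P) * ∫ ω, g ω ∂P| ≤
      c.toReal * ((∫ ω, |f ω| ∂P) * ∫ ω, |g ω| ∂P) := by
  have main : ∀ F G : Ω → ℝ, Measurable[m₁] F → Measurable[m₂] G → 0 ≤ F → 0 ≤ G →
      MemLp F 2 P → MemLp G 2 P →
      |∫ ω, F ω * G ω ∂P - (∫ ω, F ω ∂P) * ∫ ω, G ω ∂P| ≤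
        c.toReal * ((∫ ω, F ω ∂P) * ∫ ω, G ω ∂P) := fun F G hF hG hF0 hG0 hF2 hG2 =>
    abs_integral_mul_sub_le_of_nonneg hm₁ hm₂ hc h1 h2 hF hG hF0 hG0
      (hF2.integrable one_le_two) (hG2.integrable one_le_two) (hF2.integrable_mul hG2)
  set fp : Ω → ℝ := fun ω => max (f ω) 0 with hfp
  set fm : Ω → ℝ := fun ω => max (-f ω) 0 with hfm
  set gp : Ω → ℝ := fun ω => max (g ω) 0 with hgp
  set gm : Ω → ℝ := fun ω => max (-g ω) 0 with hgm
  have fpm : Measurable[m₁] fp := Measurable.max hf measurable_const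
  have fmm : Measurable[m₁] fm := Measurable.max (Measurable.neg hf) measurable_const
  have gpm : Measurable[m₂] gp := Measurable.max hg measurable_const
  have gmm : Measurable[m₂] gm := Measurable.max (Measurable.neg hg) measurable_const
  have fp0 : 0 ≤ fp := fun ω => le_max_right _ _
  have fm0 : 0 ≤ fm := fun ω => le_max_right _ _
  have gp0 : 0 ≤ gp := fun ω => le_max_right _ _
  have gm0 : 0 ≤ gm := fun ω => le_max_right _ _
  have fp2 : MemLp fp 2 P := hf2.pos_part
  have fm2 : MemLp fm 2 P := hf2.neg_part
  have gp2 : MemLp gp 2 P := hg2.pos_part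
  have gm2 : MemLp gm 2 P := hg2.neg_part
  have ef : ∀ ω, f ω = fp ω - fm ω := fun ω => by
    simp only [hfp, hfm]; rcases le_total 0 (f ω) with h | h <;> simp [h]
  have eg : ∀ ω, g ω = gp ω - gm ω := fun ω => by
    simp only [hgp, hgm]; rcases le_total 0 (g ω) with h | h <;> simp [h]
  have af : ∀ ω, |f ω| = fp ω + fm ω := fun ω => by
    simp only [hfp, hfm]
    rcases le_total 0 (f ω) with h | h <;> simp [h, abs_of_nonneg, abs_of_nonpos]
  have ag : ∀ ω, |g ω| = gp ω + gm ω := fun ω => by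
    simp only [hgp, hgm]
    rcases le_total 0 (g ω) with h | h <;> simp [h, abs_of_nonneg, abs_of_nonpos]
  have ifp := fp2.integrable one_le_two
  have ifm := fm2.integrable one_le_two
  have igp := gp2.integrable one_le_two
  have igm := gm2.integrable one_le_two
  have s1 : ∫ ω, f ω ∂P = ∫ ω, fp ω ∂P - ∫ ω, fm ω ∂P := by
    rw [← integral_sub ifp ifm]; exact integral_congr_ae (.of_forall ef)
  have s2 : ∫ ω, g ω ∂P = ∫ ω, gp ω ∂P - ∫ ω, gm ω ∂P := by
    rw [← integral_sub igp igm]; exact integral_congr_ae (.of_forall eg)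
  have s3 : ∫ ω, |f ω| ∂P = ∫ ω, fp ω ∂P + ∫ ω, fm ω ∂P := by
    rw [← integral_add ifp ifm]; exact integral_congr_ae (.of_forall af)
  have s4 : ∫ ω, |g ω| ∂P = ∫ ω, gp ω ∂P + ∫ ω, gm ω ∂P := by
    rw [← integral_add igp igm]; exact integral_congr_ae (.of_forall ag)
  have jpp : Integrable (fun ω => fp ω * gp ω) P := fp2.integrable_mul gp2
  have jpm : Integrable (fun ω => fp ω * gm ω) P := fp2.integrable_mul gm2
  have jmp : Integrable (fun ω => fm ω * gp ω) P := fm2.integrable_mul gp2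
  have jmm : Integrable (fun ω => fm ω * gm ω) P := fm2.integrable_mul gm2
  have s5 : ∫ ω, f ω * g ω ∂P = (∫ ω, fp ω * gp ω ∂P - ∫ ω, fp ω * gm ω ∂P)
      - (∫ ω, fm ω * gp ω ∂P - ∫ ω, fm ω * gm ω ∂P) := by
    have jp : Integrable (fun ω => fp ω * gp ω - fp ω * gm ω) P := jpp.sub jpm
    have jm : Integrable (fun ω => fm ω * gp ω - fm ω * gm ω) P := jmp.sub jmm
    rw [← integral_sub jpp jpm, ← integral_sub jmp jmm, ← integral_sub jp jm]
    refine integral_congr_ae (.of_forall fun ω => ?_)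
    simp only [ef ω, eg ω]
    ring
  have b1 := abs_le.mp (main fp gp fpm gpm fp0 gp0 fp2 gp2)
  have b2 := abs_le.mp (main fp gm fpm gmm fp0 gm0 fp2 gm2)
  have b3 := abs_le.mp (main fm gp fmm gpm fm0 gp0 fm2 gp2)
  have b4 := abs_le.mp (main fm gm fmm gmm fm0 gm0 fm2 gm2)
  rw [s1, s2, s3, s4, s5, abs_le]
  constructor <;> nlinarith [b1.1, b1.2, b2.1, b2.2, b3.1, b3.2, b4.1, b4.2]

end RelativeDependence

/-! ### The covariance inequality under `ψ`-mixing. -/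

section Mixing

variable {Ω E : Type*} [MeasurableSpace Ω] [MeasurableSpace E] {P : Measure Ω}
  [IsProbabilityMeasure P] {U : ℕ → Ω → E}

/-- The definition of the coefficient with denominators cleared. Null events, which the supremum
omits, make both sides zero. -/
lemma abs_measureReal_inter_sub_le {k m : ℕ} (hk : psiMixing P U k ≠ ∞) {A B : Set Ω}
    (hA : MeasurableSet[pastSigma U m] A) (hB : MeasurableSet[futureSigma U (m + k)] B) :
    |P.real A * P.real B - P.real (A ∩ B)| ≤
      (psiMixing P U k).toReal * (P.real A * P.real B) := by
  by_cases hA0 : P A = 0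
  · have h1 : P.real A = 0 := by simp [measureReal_def, hA0]
    have h2 : P.real (A ∩ B) = 0 := by
      simp [measureReal_def, measure_mono_null Set.inter_subset_left hA0]
    simp [h1, h2]
  by_cases hB0 : P B = 0
  · have h1 : P.real B = 0 := by simp [measureReal_def, hB0]
    have h2 : P.real (A ∩ B) = 0 := by
      simp [measureReal_def, measure_mono_null Set.inter_subset_right hB0]
    simp [h1, h2]
  have hle : ENNReal.ofReal |1 - P.real (A ∩ B) / P.real A / P.real B| ≤ psiMixing P U k := by
    unfold psiMixing
    refine le_iSup_of_le m (le_iSup_of_le A (le_iSup_of_le B ?_))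
    exact le_iSup_of_le hA (le_iSup_of_le hB (le_iSup_of_le hA0 (le_iSup_of_le hB0 le_rfl)))
  have hle' := (ENNReal.ofReal_le_iff_le_toReal hk).mp hle
  have pA : 0 < P.real A := ENNReal.toReal_pos hA0 (measure_ne_top _ _)
  have pB : 0 < P.real B := ENNReal.toReal_pos hB0 (measure_ne_top _ _)
  have heq : P.real A * P.real B - P.real (A ∩ B)
      = (1 - P.real (A ∩ B) / P.real A / P.real B) * (P.real A * P.real B) := by
    field_simp
  rw [heq, abs_mul, abs_of_pos (mul_pos pA pB)]
  gcongr

lemma pastSigma_le (hU : ∀ i, Measurable (U i)) (m : ℕ) :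
    pastSigma U m ≤ (inferInstance : MeasurableSpace Ω) :=
  iSup₂_le fun i _ => (hU i).comap_le

lemma futureSigma_le (hU : ∀ i, Measurable (U i)) (m : ℕ) :
    futureSigma U m ≤ (inferInstance : MeasurableSpace Ω) :=
  iSup₂_le fun i _ => (hU i).comap_le

/-- The covariance inequality for `ψ`-mixing sequences. -/
lemma abs_covariance_le_of_psiMixing (hU : ∀ i, Measurable (U i)) {k m : ℕ}
    (hk : psiMixing P U k ≠ ∞) {f g : Ω → ℝ} (hf : Measurable[pastSigma U m] f)
    (hg : Measurable[futureSigma U (m + k)] g) (hf2 : MemLp f 2 P) (hg2 : MemLp g 2 P) :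
    |cov[f, g; P]| ≤ (psiMixing P U k).toReal * ((∫ ω, |f ω| ∂P) * ∫ ω, |g ω| ∂P) := by
  rw [covariance_eq_sub hf2 hg2]
  set c := psiMixing P U k
  have hof : ∀ s, P s = ENNReal.ofReal (P.real s) := fun s => by simp
  have hc0 : 0 ≤ c.toReal := ENNReal.toReal_nonneg
  have hc' : c = ENNReal.ofReal c.toReal := (ENNReal.ofReal_toReal hk).symm
  refine abs_integral_mul_sub_le (pastSigma_le hU m) (futureSigma_le hU (m + k)) hk
    (fun A B hA hB => ?_) (fun A B hA hB => ?_) hf hg hf2 hg2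
  all_goals
    have h := abs_le.mp (abs_measureReal_inter_sub_le hk hA hB)
    have pA : 0 ≤ P.real A := measureReal_nonneg
    have pB : 0 ≤ P.real B := measureReal_nonneg
    have pAB : 0 ≤ P.real (A ∩ B) := measureReal_nonneg
    rw [hof A, hof B, hof (A ∩ B), hc']
  · rw [← ENNReal.ofReal_one, ← ENNReal.ofReal_add zero_le_one hc0, ← ENNReal.ofReal_mul pA,
      ← ENNReal.ofReal_mul (by positivity)]
    exact ENNReal.ofReal_le_ofReal (by linarith [h.1])
  · rw [← ENNReal.ofReal_mul pA, ← ENNReal.ofReal_mul hc0,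
      ← ENNReal.ofReal_add pAB (by positivity)]
    exact ENNReal.ofReal_le_ofReal (by linarith [h.2])

end Mixing

/-! ### Mean square error of sample means. -/

section SampleMeans

/-- Truncated subtraction with `a 0 = 0` makes all terms with `j ≤ i` vanish, so only positive lags
contribute. -/
lemma sum_range_tsub {a : ℕ → ℝ} (h0 : a 0 = 0) (n i : ℕ) :
    ∑ j ∈ Finset.range n, a (j - i) = ∑ k ∈ Finset.range (n - i), a k := by
  induction n with
  | zero => simp
  | succ n ih =>
    rw [Finset.sum_range_succ, ih]
    rcases le_or_gt i n with h | h
    · rw [Nat.succ_sub h, Finset.sum_range_succ]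
    · rw [Nat.sub_eq_zero_of_le h.le, Nat.sub_eq_zero_of_le h, h0, add_zero]

lemma sum_sum_tsub_le {a : ℕ → ℝ} (h0 : a 0 = 0) (hnn : ∀ k, 0 ≤ a k) (ha : Summable a) (n : ℕ) :
    ∑ i ∈ Finset.range n, ∑ j ∈ Finset.range n, a (j - i) ≤ n * ∑' k, a k := by
  have h : ∀ i ∈ Finset.range n, ∑ j ∈ Finset.range n, a (j - i) ≤ ∑' k, a k := fun i _ => by
    rw [sum_range_tsub h0]
    exact ha.sum_le_tsum _ fun k _ => hnn k
  simpa using Finset.sum_le_sum h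

lemma measurable_pastSigma {Ω E : Type*} [MeasurableSpace E] {U : ℕ → Ω → E} {f : Ω → ℝ} {i : ℕ}
    (hf : Measurable[MeasurableSpace.comap (U i) inferInstance] f) :
    Measurable[pastSigma U i] f :=
  hf.mono (le_iSup₂_of_le i le_rfl le_rfl) le_rfl

lemma measurable_futureSigma {Ω E : Type*} [MeasurableSpace E] {U : ℕ → Ω → E} {f : Ω → ℝ} {i m : ℕ} (hm : m ≤ i)
    (hf : Measurable[MeasurableSpace.comap (U i) inferInstance] f) :
    Measurable[futureSigma U m] f :=
  hf.mono (le_iSup₂_of_le i hm le_rfl) le_rfl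

variable {Ω E : Type*} [MeasurableSpace Ω] [MeasurableSpace E] {P : Measure Ω} {U : ℕ → Ω → E}

/-- The finite positive-lag mixing coefficients, with the value `0` at lag `0`. -/
def lagPsi (P : Measure Ω) (U : ℕ → Ω → E) (k : ℕ) : ℝ :=
  if k = 0 then 0 else (psiMixing P U k).toReal

/-- The constant in the variance bound for sample means. -/
def mixingConst (P : Measure Ω) (U : ℕ → Ω → E) : ℝ :=
  1 + 2 * ∑' k, lagPsi P U k

lemma lagPsi_nonneg (k : ℕ) : 0 ≤ lagPsi P U k := by
  unfold lagPsi; split_ifs <;> simp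

lemma mixingConst_pos : 0 < mixingConst P U := by
  have : 0 ≤ ∑' k, lagPsi P U k := tsum_nonneg lagPsi_nonneg
  unfold mixingConst; linarith

/-- The weights are at least one, so `b = ψ^{1/2}` is summable. Then `ψ = b² ≤ (∑ b) b` is summable,
and in particular finite at every positive lag. -/
lemma psiMixing_ne_top_and_summable (hmix : ∑' k : ℕ, ((k + 1 : ℕ) : ℝ≥0∞) *
      psiMixing P U (k + 1) ^ (1 / 2 : ℝ) < ∞) :
    (∀ k, k ≠ 0 → psiMixing P U k ≠ ∞) ∧ Summable (lagPsi P U) := by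
  set b : ℕ → ℝ≥0∞ := fun k => psiMixing P U (k + 1) ^ (1 / 2 : ℝ) with hb
  have hbsum : ∑' k, b k ≠ ∞ := by
    refine ((ENNReal.tsum_le_tsum fun k => ?_).trans_lt hmix).ne
    refine le_mul_of_one_le_left zero_le ?_
    exact_mod_cast Nat.succ_le_succ (Nat.zero_le k)
  have hsq : ∀ k, psiMixing P U (k + 1) = b k * b k := fun k => by
    simp only [hb]
    rw [← ENNReal.rpow_add_of_nonneg _ _ (by norm_num) (by norm_num)]
    norm_num
  have hle : ∀ k, psiMixing P U (k + 1) ≤ (∑' k, b k) * b k := fun k => by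
    rw [hsq]
    gcongr
    exact ENNReal.le_tsum k
  have hpsum : ∑' k, psiMixing P U (k + 1) ≠ ∞ := by
    refine ne_top_of_le_ne_top ?_ (ENNReal.tsum_le_tsum hle)
    rw [ENNReal.tsum_mul_left]
    exact ENNReal.mul_ne_top hbsum hbsum
  refine ⟨fun k hk => ?_, ?_⟩
  · obtain ⟨l, rfl⟩ := Nat.exists_eq_succ_of_ne_zero hk
    exact ENNReal.ne_top_of_tsum_ne_top hpsum l
  · rw [← summable_nat_add_iff 1]
    simpa [lagPsi] using ENNReal.summable_toReal hpsum

variable [IsProbabilityMeasure P]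

/-- The variance of `|f|` is non-negative. -/
lemma integral_abs_le_sqrt {f : Ω → ℝ} (hf : MemLp f 2 P) :
    ∫ ω, |f ω| ∂P ≤ Real.sqrt (∫ ω, f ω ^ 2 ∂P) := by
  refine Real.le_sqrt_of_sq_le ?_
  have h1 := variance_eq_sub hf.abs
  have h2 := variance_nonneg |f| P
  have h3 : ∫ ω, (|f| ^ 2) ω ∂P = ∫ ω, f ω ^ 2 ∂P :=
    integral_congr_ae (.of_forall fun ω => by simp)
  have h4 : ∫ ω, |f| ω ∂P = ∫ ω, |f ω| ∂P := rfl
  rw [h1, h3, h4] at h2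
  linarith

lemma abs_covariance_le_lagPsi (hU : ∀ i, Measurable (U i))
    (hψ : ∀ k, k ≠ 0 → psiMixing P U k ≠ ∞) {Z : ℕ → Ω → ℝ}
    (hZ : ∀ i, Measurable[MeasurableSpace.comap (U i) inferInstance] (Z i))
    (hZ2 : ∀ i, MemLp (Z i) 2 P) {v : ℝ} (hv : ∀ i, ∫ ω, Z i ω ^ 2 ∂P = v) {i j : ℕ}
    (hij : i < j) : |cov[Z i, Z j; P]| ≤ lagPsi P U (j - i) * v := by
  have hne : j - i ≠ 0 := by omega
  have hv0 : 0 ≤ v := by rw [← hv 0]; exact integral_nonneg fun ω => sq_nonneg _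
  have hj : Measurable[futureSigma U (i + (j - i))] (Z j) :=
    measurable_futureSigma (by omega) (hZ j)
  refine (abs_covariance_le_of_psiMixing hU (hψ _ hne) (measurable_pastSigma (hZ i)) hj
    (hZ2 i) (hZ2 j)).trans ?_
  simp only [lagPsi, hne, if_false]
  refine mul_le_mul_of_nonneg_left ?_ ENNReal.toReal_nonneg
  calc (∫ ω, |Z i ω| ∂P) * ∫ ω, |Z j ω| ∂P
      ≤ Real.sqrt v * Real.sqrt v := by
        have h := fun k => (integral_abs_le_sqrt (hZ2 k)).trans_eq (by rw [hv k])
        exact mul_le_mul (h i) (h j) (integral_nonneg fun ω => abs_nonneg (Z j ω))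
          (Real.sqrt_nonneg _)
    _ = v := Real.mul_self_sqrt hv0

/-- The diagonal contributes `n v`, and each of the two triangles at most `n v` times the sum of the
mixing coefficients. -/
lemma variance_sum_le (hU : ∀ i, Measurable (U i)) (hψ : ∀ k, k ≠ 0 → psiMixing P U k ≠ ∞)
    (hsum : Summable (lagPsi P U)) {Z : ℕ → Ω → ℝ}
    (hZ : ∀ i, Measurable[MeasurableSpace.comap (U i) inferInstance] (Z i))
    (hZ2 : ∀ i, MemLp (Z i) 2 P) {v : ℝ} (hv : ∀ i, ∫ ω, Z i ω ^ 2 ∂P = v) (n : ℕ) :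
    Var[fun ω => ∑ i ∈ Finset.range n, Z i ω; P] ≤ n * (mixingConst P U * v) := by
  have hv0 : 0 ≤ v := by rw [← hv 0]; exact integral_nonneg fun ω => sq_nonneg _
  rw [variance_fun_sum' fun i _ => hZ2 i]
  set a := lagPsi P U with ha
  have ha0 : a 0 = 0 := by simp [ha, lagPsi]
  have hcov : ∀ i j, cov[Z i, Z j; P] ≤ ((if i = j then 1 else 0) + a (j - i) + a (i - j)) * v := by
    intro i j
    rcases lt_trichotomy i j with h | h | h
    · have h1 := (le_abs_self _).trans (abs_covariance_le_lagPsi hU hψ hZ hZ2 hv h)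
      rw [if_neg h.ne, Nat.sub_eq_zero_of_le h.le, ha0]
      simpa using h1
    · subst h
      rw [covariance_self (hZ2 i).aemeasurable]
      have h1 := variance_le_expectation_sq (hZ2 i).1
      have h2 : ∫ ω, (Z i ^ 2) ω ∂P = v := hv i
      simp only [if_true, Nat.sub_self, ha0]
      linarith
    · rw [covariance_comm]
      have h1 := (le_abs_self _).trans (abs_covariance_le_lagPsi hU hψ hZ hZ2 hv h)
      rw [if_neg h.ne', Nat.sub_eq_zero_of_le h.le, ha0]
      simpa using h1
  refine (Finset.sum_le_sum fun i _ => Finset.sum_le_sum fun j _ => hcov i j).trans ?_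
  simp_rw [← Finset.sum_mul]
  rw [← mul_assoc]
  refine mul_le_mul_of_nonneg_right ?_ hv0
  simp_rw [Finset.sum_add_distrib]
  have h1 : ∑ i ∈ Finset.range n, ∑ j ∈ Finset.range n, (if i = j then (1 : ℝ) else 0) = n := by
    rw [Finset.sum_congr rfl fun i hi => by rw [Finset.sum_ite_eq, if_pos hi]]
    simp
  have h2 := sum_sum_tsub_le ha0 lagPsi_nonneg hsum n
  have h3 : ∑ i ∈ Finset.range n, ∑ j ∈ Finset.range n, a (i - j)
      = ∑ i ∈ Finset.range n, ∑ j ∈ Finset.range n, a (j - i) := Finset.sum_comm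
  rw [h1, h3, mixingConst]
  linarith

/-- The mean square error of the sample mean of a stationary `ψ`-mixing sequence. -/
lemma lintegral_sampleMean_sub_sq_le (hU : ∀ i, Measurable (U i))
    (hψ : ∀ k, k ≠ 0 → psiMixing P U k ≠ ∞) (hsum : Summable (lagPsi P U)) {Z : ℕ → Ω → ℝ}
    (hZ : ∀ i, Measurable[MeasurableSpace.comap (U i) inferInstance] (Z i))
    (hid : ∀ i, IdentDistrib (Z i) (Z 0) P P) {n : ℕ} (hn : 1 ≤ n) :
    ∫⁻ ω, ENNReal.ofReal (((1 / (n : ℝ)) * ∑ i ∈ Finset.range n, Z i ω - ∫ ω, Z 0 ω ∂P) ^ 2) ∂P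
      ≤ ENNReal.ofReal (mixingConst P U / n) * ∫⁻ ω, ENNReal.ofReal (Z 0 ω ^ 2) ∂P := by
  have hn' : (0 : ℝ) < n := by exact_mod_cast hn
  have hC := mixingConst_pos (P := P) (U := U)
  have hZm : ∀ i, Measurable (Z i) := fun i => (hZ i).mono (hU i).comap_le le_rfl
  -- With an infinite second moment the right side is infinite. The bound therefore holds at every
  -- argument of a random curve, with no exceptional null set.
  by_cases htop : ∫⁻ ω, ENNReal.ofReal (Z 0 ω ^ 2) ∂P = ∞
  · rw [htop, ENNReal.mul_top]
    · exact le_top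
    · rw [ne_eq, ENNReal.ofReal_eq_zero, not_le]; positivity
  have hZ0 : MemLp (Z 0) 2 P :=
    (memLp_two_iff_lintegral (hZm 0).aestronglyMeasurable).mpr (lt_top_iff_ne_top.mpr htop)
  have hZ2 : ∀ i, MemLp (Z i) 2 P := fun i => (hid i).symm.memLp_snd hZ0
  have hv : ∀ i, ∫ ω, Z i ω ^ 2 ∂P = ∫ ω, Z 0 ω ^ 2 ∂P := fun i =>
    ((hid i).comp (measurable_id.pow_const 2)).integral_eq
  have hm : ∀ i, ∫ ω, Z i ω ∂P = ∫ ω, Z 0 ω ∂P := fun i => (hid i).integral_eq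
  set S : Ω → ℝ := fun ω => ∑ i ∈ Finset.range n, Z i ω with hS
  have hS2 : MemLp S 2 P := memLp_finsetSum _ fun i _ => hZ2 i
  have hES : ∫ ω, S ω ∂P = n * ∫ ω, Z 0 ω ∂P := by
    simp only [hS]
    rw [integral_finsetSum _ fun i _ => (hZ2 i).integrable one_le_two]
    simp [hm]
  have hvar := variance_sum_le hU hψ hsum hZ hZ2 hv n
  have heq : ∀ ω, (1 / (n : ℝ) * S ω - ∫ ω, Z 0 ω ∂P) ^ 2
      = (1 / (n : ℝ) ^ 2) * (S ω - ∫ ω, S ω ∂P) ^ 2 := fun ω => by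
    rw [hES]; field_simp
  have hint : Integrable (fun ω => (S ω - ∫ ω, S ω ∂P) ^ 2) P :=
    (hS2.sub (memLp_const _)).integrable_sq
  rw [← ofReal_integral_eq_lintegral_ofReal hZ0.integrable_sq (.of_forall fun ω => sq_nonneg _),
    ← ENNReal.ofReal_mul (by positivity)]
  change ∫⁻ ω, ENNReal.ofReal ((1 / (n : ℝ) * S ω - ∫ ω, Z 0 ω ∂P) ^ 2) ∂P ≤ _
  simp_rw [heq]
  rw [← ofReal_integral_eq_lintegral_ofReal (hint.const_mul _)
    (.of_forall fun ω => by positivity), integral_const_mul]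
  refine ENNReal.ofReal_le_ofReal ?_
  rw [variance_eq_integral hS2.aemeasurable] at hvar
  calc 1 / (n : ℝ) ^ 2 * ∫ ω, (S ω - ∫ ω, S ω ∂P) ^ 2 ∂P
      ≤ 1 / (n : ℝ) ^ 2 * (n * (mixingConst P U * ∫ ω, Z 0 ω ^ 2 ∂P)) := by gcongr
    _ = _ := by field_simp

/-- The integrated mean square error of the pointwise sample mean. -/
lemma lintegral_lintegral_sampleMean_sub_sq_le {R : Type*} [MeasureSpace R]
    [SFinite (volume : Measure R)] (hU : ∀ i, Measurable (U i))
    (hψ : ∀ k, k ≠ 0 → psiMixing P U k ≠ ∞) (hsum : Summable (lagPsi P U)) {Z : ℕ → Ω → R → ℝ}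
    (hZm : ∀ i, Measurable fun p : Ω × R => Z i p.1 p.2)
    (hZ : ∀ r i, Measurable[MeasurableSpace.comap (U i) inferInstance] fun ω => Z i ω r)
    (hid : ∀ r i, IdentDistrib (fun ω => Z i ω r) (fun ω => Z 0 ω r) P P) {n : ℕ} (hn : 1 ≤ n) :
    ∫⁻ ω, (∫⁻ r, ENNReal.ofReal
        ((sampleMean (fun i => Z i ω) n r - ∫ ω, Z 0 ω r ∂P) ^ 2)) ∂P
      ≤ ENNReal.ofReal (mixingConst P U / n) *
        ∫⁻ ω, (∫⁻ r, ENNReal.ofReal (Z 0 ω r ^ 2)) ∂P := by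
  have hmean : Measurable fun r => ∫ ω, Z 0 ω r ∂P :=
    ((hZm 0).comp measurable_swap).stronglyMeasurable.integral_prod_right'.measurable
  have hmeas : Measurable fun p : Ω × R =>
      ENNReal.ofReal ((sampleMean (fun i => Z i p.1) n p.2 - ∫ ω, Z 0 ω p.2 ∂P) ^ 2) := by
    refine measurable_ofReal_sq (Measurable.sub ?_ (hmean.comp measurable_snd))
    unfold sampleMean
    exact (Finset.measurable_fun_sum _ fun i _ => hZm i).const_mul _
  rw [lintegral_lintegral_swap hmeas.aemeasurable,
    lintegral_lintegral_swap (f := fun ω r => ENNReal.ofReal (Z 0 ω r ^ 2))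
      (measurable_ofReal_sq (hZm 0)).aemeasurable,
    ← lintegral_const_mul' _ _ ENNReal.ofReal_ne_top]
  exact lintegral_mono fun r =>
    lintegral_sampleMean_sub_sq_le hU hψ hsum (hZ r) (hid r) hn

end SampleMeans

/-! ### Deterministic comparison of the criteria. -/

section InformationCriteria

variable {d r q : ℕ} {l : ℕ → ℝ} {a δ c τ γ : ℝ}

/-- The scaled sum of the discarded spectral values. -/
def tailSum (d : ℕ) (l : ℕ → ℝ) (q : ℕ) : ℝ :=
  1 / (d : ℝ) ^ 2 * ∑ k ∈ Finset.Icc (q + 1) d, l k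

lemma tailSum_nonneg (hl : ∀ k, 0 ≤ l k) (q : ℕ) : 0 ≤ tailSum d l q :=
  mul_nonneg (by positivity) (Finset.sum_nonneg fun k _ => hl k)

lemma tailSum_le (ha : 0 ≤ a) (hsmall : ∀ k, r < k → l k ≤ a) (hrd : r < d) :
    tailSum d l r ≤ a := by
  have hd : (1 : ℝ) ≤ d := by exact_mod_cast (by omega : 1 ≤ d)
  have h1 : ∑ k ∈ Finset.Icc (r + 1) d, l k ≤ d * a := by
    calc ∑ k ∈ Finset.Icc (r + 1) d, l k ≤ ∑ _k ∈ Finset.Icc (r + 1) d, a :=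
          Finset.sum_le_sum fun k hk => hsmall k (by simp at hk; omega)
      _ = ((d - r : ℕ) : ℝ) * a := by simp
      _ ≤ d * a := by gcongr; omega
  unfold tailSum
  rw [one_div, inv_mul_le_iff₀ (by positivity)]
  nlinarith [mul_nonneg (sub_nonneg.mpr hd) ha]

lemma add_le_tailSum (hl : ∀ k, 0 ≤ l k) (hqr : q < r) (hrd : r < d) :
    tailSum d l r + 1 / (d : ℝ) ^ 2 * l r ≤ tailSum d l q := by
  unfold tailSum
  rw [← mul_add]
  gcongr
  rw [add_comm, ← Finset.sum_insert (by simp)]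
  refine Finset.sum_le_sum_of_subset_of_nonneg ?_ fun k _ _ => hl k
  intro k hk
  simp only [Finset.mem_insert, Finset.mem_Icc] at hk ⊢
  omega

lemma penalty_gap (hτ : 0 < τ) (hγ : 0 < γ) (hrq : r < q) : τ * r * γ + τ * γ ≤ τ * q * γ := by
  have h : (r : ℝ) + 1 ≤ q := by exact_mod_cast hrq
  nlinarith [mul_pos hτ hγ]

lemma penalty_le (hτ : 0 < τ) (hγ : 0 < γ) (hrd : r < d) :
    τ * r * γ ≤ τ * d * γ + τ * q * γ := by
  have h : (r : ℝ) ≤ d := by exact_mod_cast hrd.le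
  have h1 : 0 ≤ τ * q * γ := by positivity
  have h2 : τ * r * γ ≤ τ * d * γ := by gcongr
  linarith

/-- Here `a` is the noise level and `δ` the signal at index `r`. For `q < r` the sum at `q` retains
`l r`, which outweighs every penalty; for `q > r` one penalty step `τ γ` outweighs the noise. -/
lemma IC₁_lt (hl : ∀ k, 0 ≤ l k) (ha : 0 ≤ a) (hsmall : ∀ k, r < k → l k ≤ a)
    (hbig : 1 ≤ r → δ ≤ l r) (hrd : r < d) (hτ : 0 < τ) (hγ : 0 < γ) (haγ : a < τ * γ)
    (hδγ : 1 ≤ r → τ * d * γ < 1 / (d : ℝ) ^ 2 * δ) (hqr : q ≠ r) :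
    IC₁ d τ γ l r < IC₁ d τ γ l q := by
  change tailSum d l r + τ * r * γ < tailSum d l q + τ * q * γ
  rcases lt_or_gt_of_ne hqr with h | h
  · have h1 := add_le_tailSum hl h hrd
    have h2 := hδγ (by omega)
    have h3 : 1 / (d : ℝ) ^ 2 * δ ≤ 1 / (d : ℝ) ^ 2 * l r :=
      mul_le_mul_of_nonneg_left (hbig (by omega)) (by positivity)
    have h4 := penalty_le (q := q) hτ hγ hrd
    linarith
  · have h1 := tailSum_le ha hsmall hrd
    have h2 := tailSum_nonneg (d := d) hl q
    have h3 := penalty_gap hτ hγ h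
    linarith

lemma IC₂_lt (hl : ∀ k, 0 ≤ l k) (ha : 0 ≤ a) (ha1 : a ≤ 1) (hsmall : ∀ k, r < k → l k ≤ a)
    (hδ : 1 ≤ r → 0 < δ) (hbig : 1 ≤ r → δ ≤ l r) (hrd : r < d) (hc : 0 < c) (hτ : 0 < τ)
    (hγ : 0 < γ) (haγ : a / c < τ * γ)
    (hδγ : 1 ≤ r → τ * d * γ < Real.log (1 + 1 / (d : ℝ) ^ 2 * δ / (c + 1))) (hqr : q ≠ r) :
    IC₂ d c τ γ l r < IC₂ d c τ γ l q := by
  change Real.log (c + tailSum d l r) + τ * r * γ < Real.log (c + tailSum d l q) + τ * q * γ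
  have hr0 := tailSum_nonneg (d := d) hl r
  have hq0 := tailSum_nonneg (d := d) hl q
  have hra := tailSum_le ha hsmall hrd
  have hd : (0 : ℝ) < d := by exact_mod_cast (by omega : 0 < d)
  rcases lt_or_gt_of_ne hqr with h | h
  · have h1 := add_le_tailSum hl h hrd
    have h2 := hδγ (by omega)
    have hδ0 := hδ (by omega)
    set e := 1 / (d : ℝ) ^ 2 * δ with he
    have he0 : 0 < e := by positivity
    have h3 : e ≤ 1 / (d : ℝ) ^ 2 * l r :=
      mul_le_mul_of_nonneg_left (hbig (by omega)) (by positivity)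
    have h4 := penalty_le (q := q) hτ hγ hrd
    have h5 : Real.log (1 + e / (c + 1)) + Real.log (c + tailSum d l r)
        ≤ Real.log (c + tailSum d l q) := by
      rw [← Real.log_mul (by positivity) (by positivity)]
      refine Real.log_le_log (by positivity) ?_
      -- The tail sum at `r` is at most `a ≤ 1`, so the argument of the logarithm grows by a factor
      -- of at least `1 + e / (c + 1)`.
      have h6 : e / (c + 1) * (c + tailSum d l r) ≤ e := by
        rw [div_mul_eq_mul_div, div_le_iff₀ (by positivity)]
        gcongr
        linarith
      rw [add_mul, one_mul]
      linarith
    linarith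
  · have h3 := penalty_gap hτ hγ h
    have h4 : Real.log (c + tailSum d l r) ≤ Real.log c + a / c := by
      have h5 : Real.log ((c + tailSum d l r) / c) ≤ (c + tailSum d l r) / c - 1 :=
        Real.log_le_sub_one_of_pos (by positivity)
      rw [Real.log_div (by positivity) hc.ne', add_div, div_self hc.ne'] at h5
      have h6 : tailSum d l r / c ≤ a / c := by gcongr
      linarith
    have h7 : Real.log c ≤ Real.log (c + tailSum d l q) :=
      Real.log_le_log hc (by linarith)
    linarith

end InformationCriteria

/-! ### Limits in probability. -/

section Limits

variable {Ω : Type*} [MeasurableSpace Ω] {P : Measure Ω}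

/-- Subadditivity of outer measure gives `1 ≤ P A + P Aᶜ` without measurability. -/
lemma probTendsToOne_of_compl_subset [IsProbabilityMeasure P] {A B : ℕ → Set Ω}
    (hB : Tendsto (fun n => P (B n)) atTop (𝓝 0)) (h : ∀ᶠ n in atTop, (A n)ᶜ ⊆ B n) :
    ProbTendsToOne P A := by
  have hc : Tendsto (fun n => P (A n)ᶜ) atTop (𝓝 0) :=
    tendsto_of_tendsto_of_tendsto_of_le_of_le' tendsto_const_nhds hB
      (.of_forall fun n => zero_le) (h.mono fun n hn => measure_mono hn)
  refine ⟨?_, hc⟩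
  have hle : ∀ n, 1 - P (A n)ᶜ ≤ P (A n) := fun n => by
    rw [tsub_le_iff_right]
    calc 1 = P (A n ∪ (A n)ᶜ) := by simp
      _ ≤ _ := measure_union_le _ _
  have h1 : Tendsto (fun n => 1 - P (A n)ᶜ) atTop (𝓝 (1 - 0)) :=
    ENNReal.Tendsto.sub tendsto_const_nhds hc (Or.inl ENNReal.one_ne_top)
  rw [tsub_zero] at h1
  exact tendsto_of_tendsto_of_tendsto_of_le_of_le h1 tendsto_const_nhds hle fun n => prob_le_one

/-- Markov's inequality for a sequence with expectations of order `1/n`. -/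
lemma tendsto_measure_ofReal_le {W : ℕ → Ω → ℝ≥0∞} (hW : ∀ n, Measurable (W n)) {C : ℝ}
    {M : ℝ≥0∞} (hM : M ≠ ∞)
    (hle : ∀ n, 1 ≤ n → ∫⁻ ω, W n ω ∂P ≤ ENNReal.ofReal (C / n) * M) {a : ℕ → ℝ}
    (ha : Tendsto (fun n : ℕ => (n : ℝ) * a n) atTop atTop) :
    Tendsto (fun n => P {ω | ENNReal.ofReal (a n) ≤ W n ω}) atTop (𝓝 0) := by
  have hlim : Tendsto (fun n : ℕ => ENNReal.ofReal (C / ((n : ℝ) * a n)) * M) atTop (𝓝 0) := by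
    have h1 : Tendsto (fun n : ℕ => ENNReal.ofReal (C / ((n : ℝ) * a n))) atTop (𝓝 0) := by
      rw [← ENNReal.ofReal_zero]
      exact ENNReal.tendsto_ofReal (ha.const_div_atTop C)
    simpa using ENNReal.Tendsto.mul_const h1 (Or.inr hM)
  refine tendsto_of_tendsto_of_tendsto_of_le_of_le' tendsto_const_nhds hlim
    (.of_forall fun n => zero_le) ?_
  filter_upwards [eventually_ge_atTop 1, ha.eventually_gt_atTop 0] with n hn hna
  have hn0 : (0 : ℝ) < n := by exact_mod_cast hn
  have han : 0 < a n := pos_of_mul_pos_right hna hn0.le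
  calc P {ω | ENNReal.ofReal (a n) ≤ W n ω}
      ≤ (∫⁻ ω, W n ω ∂P) / ENNReal.ofReal (a n) :=
        meas_ge_le_lintegral_div (hW n).aemeasurable
          (by rw [ne_eq, ENNReal.ofReal_eq_zero, not_le]; exact han) ENNReal.ofReal_ne_top
    _ ≤ (ENNReal.ofReal (C / n) * M) / ENNReal.ofReal (a n) := by gcongr; exact hle n hn
    _ = ENNReal.ofReal (C / ((n : ℝ) * a n)) * M := by
        rw [← div_div, ENNReal.ofReal_div_of_pos han, ENNReal.mul_div_right_comm]

end Limits

/-! ### Decomposition of the sample covariance kernel. -/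

section SampleCovariance

variable {S T : Type*}

/-- The pointwise tensor product of two curves. -/
def tensor (y : S → ℝ) (x : T → ℝ) (p : S × T) : ℝ := y p.1 * x p.2

lemma sampleCrossCov_eq [MeasureSpace S] [MeasureSpace T] (y : ℕ → S → ℝ) (x : ℕ → T → ℝ) {n : ℕ}
    (hn : 1 ≤ n) (u : S) (v : T) :
    sampleCrossCov y x n u v = sampleMean (fun i => tensor (y i) (x i)) n (u, v)
      - sampleMean y n u * sampleMean x n v := by
  have hn0 : (n : ℝ) ≠ 0 := by positivity
  have h1 : ∑ i ∈ Finset.range n, y i u = n * sampleMean y n u := by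
    unfold sampleMean; field_simp
  have h2 : ∑ i ∈ Finset.range n, x i v = n * sampleMean x n v := by
    unfold sampleMean; field_simp
  have h3 : ∑ i ∈ Finset.range n, (y i u - sampleMean y n u) * (x i v - sampleMean x n v)
      = ∑ i ∈ Finset.range n, y i u * x i v - n * (sampleMean y n u * sampleMean x n v) := by
    simp_rw [sub_mul, mul_sub, Finset.sum_sub_distrib, ← Finset.sum_mul, ← Finset.mul_sum, h1, h2]
    simp
    ring
  unfold sampleCrossCov
  rw [h3]
  conv_rhs => rw [sampleMean]
  simp only [tensor]
  field_simp

variable [MeasureSpace S] [MeasureSpace T]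

lemma measurable_sampleMean {R : Type*} [MeasurableSpace R] {y : ℕ → R → ℝ}
    (hy : ∀ i, Measurable (y i)) (n : ℕ) : Measurable (sampleMean y n) :=
  (Finset.measurable_fun_sum _ fun i _ => hy i).const_mul _

lemma memLp_sampleMean {R : Type*} [MeasurableSpace R] {μ : Measure R} {y : ℕ → R → ℝ}
    (hy : ∀ i, MemLp (y i) 2 μ) (n : ℕ) : MemLp (sampleMean y n) 2 μ :=
  (memLp_finsetSum _ fun i _ => hy i).const_mul _

variable [SFinite (volume : Measure T)]

lemma isHS_sampleCrossCov {y : ℕ → S → ℝ} {x : ℕ → T → ℝ} (hy : ∀ i, Measurable (y i))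
    (hx : ∀ i, Measurable (x i)) (hy2 : ∀ i, MemLp (y i) 2 volume)
    (hx2 : ∀ i, MemLp (x i) 2 volume) (n : ℕ) :
    ∃ h : IsHS (sampleCrossCov y x n), IsCompactOperator (kernelOp h) := by
  have heq : sampleCrossCov y x n = fun u v => ∑ i ∈ Finset.range n,
      ((1 / (n : ℝ)) * (y i u - sampleMean y n u)) * (x i v - sampleMean x n v) := by
    funext u v
    simp only [sampleCrossCov, Finset.mul_sum, mul_assoc]
  rw [heq]
  exact isHS_sum_mul (Finset.range n)
    (fun i => ((hy i).sub (measurable_sampleMean hy n)).const_mul _)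
    (fun i => (hx i).sub (measurable_sampleMean hx n))
    (fun i _ => ((hy2 i).sub (memLp_sampleMean hy2 n)).const_mul _)
    (fun i _ => (hx2 i).sub (memLp_sampleMean hx2 n))

/-- The squared `L²` distance between the sample mean and a function. -/
def meanError {R : Type*} [MeasureSpace R] (y : ℕ → R → ℝ) (m : R → ℝ) (n : ℕ) : ℝ≥0∞ :=
  ∫⁻ r, ENNReal.ofReal ((sampleMean y n r - m r) ^ 2)

/-- The centring term is the rank-one kernel `ȳ ⊗ x̄`, whose squared norm factorises. The rest is
`(s - t)² ≤ 2 s² + 2 t²`. -/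
lemma hsSq_sampleCrossCov_sub_le {y : ℕ → S → ℝ} {x : ℕ → T → ℝ} (hy : ∀ i, Measurable (y i))
    (hx : ∀ i, Measurable (x i)) (m : S × T → ℝ) {n : ℕ} (hn : 1 ≤ n) :
    hsSq (fun u v => sampleCrossCov y x n u v - m (u, v)) ≤
      2 * meanError (fun i => tensor (y i) (x i)) m n
        + 2 * (meanError y 0 n * meanError x 0 n) := by
  have hyn := measurable_sampleMean hy n
  have hxn := measurable_sampleMean hx n
  have hmul : meanError y 0 n * meanError x 0 n
      = hsSq fun u v => sampleMean y n u * sampleMean x n v := by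
    rw [hsSq_mul hyn hxn]
    simp [meanError]
  have hmeas : Measurable fun p : S × T =>
      2 * ENNReal.ofReal ((sampleMean y n p.1 * sampleMean x n p.2) ^ 2) :=
    (measurable_ofReal_sq ((hyn.comp measurable_fst).mul (hxn.comp measurable_snd))).const_mul _
  rw [hmul]
  unfold hsSq meanError
  rw [← lintegral_const_mul' _ _ ENNReal.ofNat_ne_top,
    ← lintegral_const_mul' _ _ ENNReal.ofNat_ne_top, ← lintegral_add_right _ hmeas]
  refine lintegral_mono fun p => ?_
  simp only [sampleCrossCov_eq y x hn]
  have h2 : (2 : ℝ≥0∞) = ENNReal.ofReal 2 := by simp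
  rw [h2, ← ENNReal.ofReal_mul zero_le_two, ← ENNReal.ofReal_mul zero_le_two,
    ← ENNReal.ofReal_add (by positivity) (by positivity)]
  refine ENNReal.ofReal_le_ofReal ?_
  simp only [Prod.mk.eta]
  nlinarith [sq_nonneg (sampleMean (fun i => tensor (y i) (x i)) n p - m p
    + sampleMean y n p.1 * sampleMean x n p.2)]

end SampleCovariance

/-! ### The curve model and the rate of the covariance estimator. -/

section Model

set_option linter.unusedSectionVars false

variable {Ω S T : Type*} [MeasurableSpace Ω] [MeasureSpace S] [MeasureSpace T]

/-- Stationary `ψ`-mixing pairs of centred random curves with finite fourth moments of the norm. -/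
structure IsMixingCurveModel (P : Measure Ω) (Y : ℕ → Ω → S → ℝ) (X : ℕ → Ω → T → ℝ) : Prop where
  measurable_fst : ∀ i, Measurable fun p : Ω × S => Y i p.1 p.2
  measurable_snd : ∀ i, Measurable fun p : Ω × T => X i p.1 p.2
  mean_fst : ∀ i u, ∫ ω, Y i ω u ∂P = 0
  mean_snd : ∀ i v, ∫ ω, X i ω v ∂P = 0
  stationary : StrictlyStationary P fun i ω => (Y i ω, X i ω)
  mixing : ∑' k : ℕ, ((k + 1 : ℕ) : ℝ≥0∞) *
    psiMixing P (fun i ω => (Y i ω, X i ω)) (k + 1) ^ (1 / 2 : ℝ) < ∞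
  moment : ∀ i, ∫⁻ ω, ((∫⁻ u, ENNReal.ofReal (Y i ω u ^ 2))
    + ∫⁻ v, ENNReal.ofReal (X i ω v ^ 2)) ^ 2 ∂P < ∞

namespace IsMixingCurveModel

variable {P : Measure Ω} {Y : ℕ → Ω → S → ℝ} {X : ℕ → Ω → T → ℝ}

lemma measurable_curve_fst (h : IsMixingCurveModel P Y X) (i : ℕ) (ω : Ω) : Measurable (Y i ω) :=
  (h.measurable_fst i).comp measurable_prodMk_left

lemma measurable_curve_snd (h : IsMixingCurveModel P Y X) (i : ℕ) (ω : Ω) : Measurable (X i ω) :=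
  (h.measurable_snd i).comp measurable_prodMk_left

lemma measurable_pair (h : IsMixingCurveModel P Y X) (i : ℕ) :
    Measurable fun ω => (Y i ω, X i ω) :=
  (measurable_pi_lambda _ fun _ => (h.measurable_fst i).comp measurable_prodMk_right).prodMk
    (measurable_pi_lambda _ fun _ => (h.measurable_snd i).comp measurable_prodMk_right)

lemma identDistrib (h : IsMixingCurveModel P Y X) {φ : (S → ℝ) × (T → ℝ) → ℝ} (hφ : Measurable φ)
    (i : ℕ) : IdentDistrib (fun ω => φ (Y i ω, X i ω)) (fun ω => φ (Y 0 ω, X 0 ω)) P P := by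
  have := (h.stationary i).comp (u := fun z : ℕ → (S → ℝ) × (T → ℝ) => φ (z 0))
    (hφ.comp (measurable_pi_apply 0))
  simpa [Function.comp_def] using this

variable [IsProbabilityMeasure P]

lemma crossCov_eq (h : IsMixingCurveModel P Y X) (u : S) (v : T) :
    crossCov P (Y 0) (X 0) u v = ∫ ω, tensor (Y 0 ω) (X 0 ω) (u, v) ∂P := by
  simp [crossCov, covariance, tensor, h.mean_fst, h.mean_snd]

variable [SFinite (volume : Measure S)] [SFinite (volume : Measure T)]

lemma measurable_lintegral_fst (h : IsMixingCurveModel P Y X) (i : ℕ) :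
    Measurable fun ω => ∫⁻ u, ENNReal.ofReal (Y i ω u ^ 2) :=
  (measurable_ofReal_sq (h.measurable_fst i)).lintegral_prod_right'

lemma measurable_lintegral_snd (h : IsMixingCurveModel P Y X) (i : ℕ) :
    Measurable fun ω => ∫⁻ v, ENNReal.ofReal (X i ω v ^ 2) :=
  (measurable_ofReal_sq (h.measurable_snd i)).lintegral_prod_right'

lemma ae_memLp (h : IsMixingCurveModel P Y X) :
    ∀ᵐ ω ∂P, ∀ i, MemLp (Y i ω) 2 volume ∧ MemLp (X i ω) 2 volume := by
  rw [ae_all_iff]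
  intro i
  filter_upwards [ae_lt_top
    (((h.measurable_lintegral_fst i).add (h.measurable_lintegral_snd i)).pow_const 2)
    (h.moment i).ne] with ω hω
  have h1 : ((∫⁻ u, ENNReal.ofReal (Y i ω u ^ 2)) + ∫⁻ v, ENNReal.ofReal (X i ω v ^ 2)) < ∞ := by
    by_contra hcon
    rw [not_lt, top_le_iff] at hcon
    simp [hcon] at hω
  rw [memLp_two_iff_lintegral (h.measurable_curve_fst i ω).aestronglyMeasurable,
    memLp_two_iff_lintegral (h.measurable_curve_snd i ω).aestronglyMeasurable]
  exact ENNReal.add_lt_top.mp h1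

lemma self_le_one_add_sq (x : ℝ≥0∞) : x ≤ 1 + x ^ 2 := by
  rcases le_total x 1 with h | h
  · exact h.trans le_self_add
  · rw [sq]
    exact (le_mul_of_one_le_left zero_le h).trans le_add_self

lemma lintegral_one_add_ne_top (h : IsMixingCurveModel P Y X) :
    ∫⁻ ω, (1 + ((∫⁻ u, ENNReal.ofReal (Y 0 ω u ^ 2))
      + ∫⁻ v, ENNReal.ofReal (X 0 ω v ^ 2)) ^ 2) ∂P ≠ ∞ := by
  rw [lintegral_add_left measurable_const]
  simpa using (h.moment 0).ne

lemma lintegral_fst_ne_top (h : IsMixingCurveModel P Y X) :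
    ∫⁻ ω, (∫⁻ u, ENNReal.ofReal (Y 0 ω u ^ 2)) ∂P ≠ ∞ :=
  ne_top_of_le_ne_top h.lintegral_one_add_ne_top
    (lintegral_mono fun _ => le_self_add.trans (self_le_one_add_sq _))

lemma lintegral_snd_ne_top (h : IsMixingCurveModel P Y X) :
    ∫⁻ ω, (∫⁻ v, ENNReal.ofReal (X 0 ω v ^ 2)) ∂P ≠ ∞ :=
  ne_top_of_le_ne_top h.lintegral_one_add_ne_top
    (lintegral_mono fun _ => le_add_self.trans (self_le_one_add_sq _))

/-- The squared norm of the tensor is `‖Y‖² ‖X‖² ≤ (‖Y‖² + ‖X‖²)²`; this is where the moment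
condition is needed in full. -/
lemma lintegral_tensor_ne_top (h : IsMixingCurveModel P Y X) :
    ∫⁻ ω, (∫⁻ p, ENNReal.ofReal (tensor (Y 0 ω) (X 0 ω) p ^ 2)) ∂P ≠ ∞ := by
  refine ne_top_of_le_ne_top (h.moment 0).ne (lintegral_mono fun ω => ?_)
  have := hsSq_mul (h.measurable_curve_fst 0 ω) (h.measurable_curve_snd 0 ω)
  simp only [hsSq] at this
  simp only [tensor]
  rw [this, sq]
  gcongr
  · exact le_self_add
  · exact le_add_self

/-- The error of the sample covariance kernel in squared Hilbert–Schmidt norm. -/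
def covError (P : Measure Ω) (Y : ℕ → Ω → S → ℝ) (X : ℕ → Ω → T → ℝ) (n : ℕ) (ω : Ω) : ℝ≥0∞ :=
  hsSq fun u v => sampleCrossCov (fun i => Y i ω) (fun i => X i ω) n u v
    - crossCov P (Y 0) (X 0) u v

/-- A general functional `φ` of the pair lets one argument cover the tensors and both marginal
curves. -/
lemma tendsto_measure_meanError (h : IsMixingCurveModel P Y X) {R : Type*} [MeasureSpace R]
    [SFinite (volume : Measure R)] {φ : (S → ℝ) × (T → ℝ) → R → ℝ}
    (hφ : ∀ r, Measurable fun z => φ z r)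
    (hm : ∀ i, Measurable fun p : Ω × R => φ (Y i p.1, X i p.1) p.2) {m : R → ℝ}
    (hmean : ∀ r, ∫ ω, φ (Y 0 ω, X 0 ω) r ∂P = m r)
    (hfin : ∫⁻ ω, (∫⁻ r, ENNReal.ofReal (φ (Y 0 ω, X 0 ω) r ^ 2)) ∂P ≠ ∞) {a : ℕ → ℝ}
    (ha : Tendsto (fun n : ℕ => (n : ℝ) * a n) atTop atTop) :
    Tendsto (fun n => P {ω | ENNReal.ofReal (a n) ≤ meanError (fun i => φ (Y i ω, X i ω)) m n})
      atTop (𝓝 0) := by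
  obtain ⟨hψ, hsum⟩ := psiMixing_ne_top_and_summable h.mixing
  have hmm : Measurable m := by
    have : m = fun r => ∫ ω, φ (Y 0 ω, X 0 ω) r ∂P := funext fun r => (hmean r).symm
    rw [this]
    exact ((hm 0).comp measurable_swap).stronglyMeasurable.integral_prod_right'.measurable
  refine tendsto_measure_ofReal_le (fun n => ?_) (C := mixingConst P fun i ω => (Y i ω, X i ω))
    hfin (fun n hn => ?_) ha
  · have : Measurable fun p : Ω × R => ENNReal.ofReal
        ((sampleMean (fun i => φ (Y i p.1, X i p.1)) n p.2 - m p.2) ^ 2) := by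
      refine measurable_ofReal_sq (Measurable.sub ?_ (hmm.comp _root_.measurable_snd))
      exact (Finset.measurable_fun_sum _ fun i _ => hm i).const_mul _
    exact this.lintegral_prod_right'
  · have := lintegral_lintegral_sampleMean_sub_sq_le h.measurable_pair hψ hsum
      (Z := fun i ω r => φ (Y i ω, X i ω) r) hm
      (fun r i => (hφ r).comp (comap_measurable _)) (fun r i => h.identDistrib (hφ r) i) hn
    simp only [hmean] at this
    exact this

/-- The sample covariance kernel converges in Hilbert–Schmidt norm at the rate `n^{-1/2}`. -/
lemma tendsto_measure_covError (h : IsMixingCurveModel P Y X) {a : ℕ → ℝ}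
    (ha : Tendsto (fun n : ℕ => (n : ℝ) * a n) atTop atTop) :
    Tendsto (fun n => P {ω | ENNReal.ofReal (a n) ≤ covError P Y X n ω}) atTop (𝓝 0) := by
  have ha4 : Tendsto (fun n : ℕ => (n : ℝ) * (a n / 4)) atTop atTop := by
    simp_rw [← mul_div_assoc]
    exact ha.atTop_div_const (by norm_num)
  -- In the product of the two mean errors, one factor below `1` and the other below `a n / 4`
  -- suffice. With the tensor error also below `a n / 4`, the two doubled terms add up to less than
  -- `a n`.
  have hone : Tendsto (fun n : ℕ => (n : ℝ) * 1) atTop atTop := by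
    simpa using tendsto_natCast_atTop_atTop
  have hZ := h.tendsto_measure_meanError (φ := fun z => tensor z.1 z.2)
    (m := fun p => crossCov P (Y 0) (X 0) p.1 p.2)
    (fun p => by unfold tensor; fun_prop)
    (fun i => ((h.measurable_fst i).comp
        (_root_.measurable_fst.prodMk (_root_.measurable_fst.comp _root_.measurable_snd))).mul
      ((h.measurable_snd i).comp
        (_root_.measurable_fst.prodMk (_root_.measurable_snd.comp _root_.measurable_snd))))
    (fun p => (h.crossCov_eq p.1 p.2).symm) h.lintegral_tensor_ne_top ha4
  have hY := h.tendsto_measure_meanError (φ := fun z => z.1) (m := 0) (fun r => by fun_prop)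
    h.measurable_fst (h.mean_fst 0) h.lintegral_fst_ne_top ha4
  have hX := h.tendsto_measure_meanError (φ := fun z => z.2) (m := 0) (fun r => by fun_prop)
    h.measurable_snd (h.mean_snd 0) h.lintegral_snd_ne_top hone
  have hsum := (hZ.add hY).add hX
  rw [add_zero, add_zero] at hsum
  refine tendsto_of_tendsto_of_tendsto_of_le_of_le' tendsto_const_nhds hsum
    (.of_forall fun n => zero_le) ?_
  filter_upwards [eventually_ge_atTop 1, ha.eventually_gt_atTop 0] with n hn hna
  have han : 0 < a n := pos_of_mul_pos_right hna (Nat.cast_nonneg n)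
  refine (measure_mono ?_).trans ((measure_union_le _ _).trans
    (add_le_add_left (measure_union_le _ _) _))
  intro ω hω
  by_contra hcon
  simp only [Set.mem_union, Set.mem_ofPred_eq, not_or, not_le, ENNReal.ofReal_one] at hcon hω
  obtain ⟨⟨h1, h2⟩, h3⟩ := hcon
  have hle := hsSq_sampleCrossCov_sub_le (fun i => h.measurable_curve_fst i ω)
    (fun i => h.measurable_curve_snd i ω) (fun p => crossCov P (Y 0) (X 0) p.1 p.2) hn
  have hlt : covError P Y X n ω < ENNReal.ofReal (a n) := by
    refine hle.trans_lt ?_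
    have h4 : meanError (fun i => Y i ω) 0 n * meanError (fun i => X i ω) 0 n
        < ENNReal.ofReal (a n / 4) := (mul_le_of_le_one_right zero_le h3.le).trans_lt h2
    calc _ < 2 * ENNReal.ofReal (a n / 4) + 2 * ENNReal.ofReal (a n / 4) := by
          refine ENNReal.add_lt_add ?_ ?_
          · exact (ENNReal.mul_lt_mul_iff_right two_ne_zero ENNReal.ofNat_ne_top).mpr h1
          · exact (ENNReal.mul_lt_mul_iff_right two_ne_zero ENNReal.ofNat_ne_top).mpr h4
      _ = ENNReal.ofReal (a n) := by
          have e2 : (2 : ℝ≥0∞) = ENNReal.ofReal 2 := by simp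
          rw [e2, ← ENNReal.ofReal_mul zero_le_two,
            ← ENNReal.ofReal_add (by positivity) (by positivity)]
          congr 1
          ring
  exact absurd hω (not_le.mpr hlt)

/-- A probabilistic existence argument: for some `n` a large error has probability below one, so it
cannot hold at almost every outcome with square-integrable curves. -/
lemma exists_covError_lt (h : IsMixingCurveModel P Y X) {ε : ℝ} (hε : 0 < ε) :
    ∃ n ω, (∀ i, MemLp (Y i ω) 2 volume ∧ MemLp (X i ω) 2 volume) ∧
      covError P Y X n ω < ENNReal.ofReal ε := by
  have ht := h.tendsto_measure_covError (a := fun _ => ε)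
    (tendsto_natCast_atTop_atTop.atTop_mul_const hε)
  obtain ⟨n, hn⟩ := (ht.eventually_lt_const one_pos).exists
  by_contra! hcon
  have hae : {ω | ENNReal.ofReal ε ≤ covError P Y X n ω} =ᵐ[P] Set.univ := by
    rw [eventuallyEq_univ]
    filter_upwards [h.ae_memLp] with ω hω using hcon n ω hω
  have h1 : P {ω | ENNReal.ofReal ε ≤ covError P Y X n ω} = 1 := by
    rw [measure_congr hae, measure_univ]
  exact hn.ne h1

lemma measurable_crossCov (h : IsMixingCurveModel P Y X) :
    Measurable fun p : S × T => crossCov P (Y 0) (X 0) p.1 p.2 := by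
  simp_rw [h.crossCov_eq]
  have : Measurable fun q : (S × T) × Ω => tensor (Y 0 q.2) (X 0 q.2) (q.1.1, q.1.2) :=
    ((h.measurable_fst 0).comp (_root_.measurable_snd.prodMk
        (_root_.measurable_fst.comp _root_.measurable_fst))).mul
      ((h.measurable_snd 0).comp (_root_.measurable_snd.prodMk
        (_root_.measurable_snd.comp _root_.measurable_fst)))
  exact this.stronglyMeasurable.integral_prod_right'.measurable

lemma isHS_sample (h : IsMixingCurveModel P Y X) {ω : Ω}
    (hω : ∀ i, MemLp (Y i ω) 2 volume ∧ MemLp (X i ω) 2 volume) (n : ℕ) :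
    ∃ hs : IsHS (sampleCrossCov (fun i => Y i ω) (fun i => X i ω) n),
      IsCompactOperator (kernelOp hs) :=
  isHS_sampleCrossCov (fun i => h.measurable_curve_fst i ω) (fun i => h.measurable_curve_snd i ω)
    (fun i => (hω i).1) (fun i => (hω i).2) n

/-- `Σ = Σ̂ - (Σ̂ - Σ)` at a single realisation where both terms are Hilbert–Schmidt. -/
lemma isHS_crossCov (h : IsMixingCurveModel P Y X) : IsHS (crossCov P (Y 0) (X 0)) := by
  obtain ⟨n, ω, hω, hlt⟩ := h.exists_covError_lt one_pos
  obtain ⟨hs, -⟩ := h.isHS_sample hω n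
  have hdiff : IsHS fun u v => sampleCrossCov (fun i => Y i ω) (fun i => X i ω) n u v
      - crossCov P (Y 0) (X 0) u v :=
    ⟨hs.measurable.sub h.measurable_crossCov, hlt.trans ENNReal.ofReal_lt_top⟩
  simpa using hs.sub hdiff

lemma isCompactOperator_crossCov (h : IsMixingCurveModel P Y X) :
    IsCompactOperator (kernelOp h.isHS_crossCov) := by
  refine isCompactOperator_kernelOp_of_forall h.isHS_crossCov fun ε hε => ?_
  obtain ⟨n, ω, hω, hlt⟩ := h.exists_covError_lt (ε := ε ^ 2) (by positivity)
  obtain ⟨hs, hc⟩ := h.isHS_sample hω n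
  refine ⟨_, hs, hc, ?_⟩
  rw [Real.sqrt_le_left hε.le]
  exact ENNReal.toReal_le_of_le_ofReal (by positivity) hlt.le

end IsMixingCurveModel

end Model

/-! ### Consistency of the selected dimension. -/

section Consistency

variable {Ω S T : Type*} [MeasurableSpace Ω] [MeasureSpace S] [MeasureSpace T]
  [SFinite (volume : Measure S)] [SFinite (volume : Measure T)]
  {P : Measure Ω} [IsProbabilityMeasure P] {Y : ℕ → Ω → S → ℝ} {X : ℕ → Ω → T → ℝ}

namespace IsMixingCurveModel

/-- Where the sample covariance kernel is within `√a` of its target, the estimated spectral values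
of index beyond the rank are at most `a`, and the one of index `r` is not much below its target. -/
lemma lamHat_bounds (h : IsMixingCurveModel P Y X) {r : ℕ}
    (hzero : ∀ k, r < k → lam (crossCov P (Y 0) (X 0)) k = 0) {ω : Ω}
    (hω : ∀ i, MemLp (Y i ω) 2 volume ∧ MemLp (X i ω) 2 volume) {n : ℕ} {a : ℝ} (ha : 0 ≤ a)
    (herr : covError P Y X n ω < ENNReal.ofReal a) :
    (∀ k, r < k → lamHat Y X n ω k ≤ a) ∧
      (1 ≤ r → a ≤ lam (crossCov P (Y 0) (X 0)) r / 4 →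
        lam (crossCov P (Y 0) (X 0)) r / 4 ≤ lamHat Y X n ω r) := by
  obtain ⟨hs, hsc⟩ := h.isHS_sample hω n
  have hL := h.isHS_crossCov
  have hLc := h.isCompactOperator_crossCov
  have hsq : Real.sqrt (covError P Y X n ω).toReal ≤ Real.sqrt a :=
    Real.sqrt_le_sqrt (ENNReal.toReal_le_of_le_ofReal ha herr.le)
  refine ⟨fun k hk => ?_, fun hr hle => ?_⟩
  · have h1 := sqrt_lam_le_add hs hL hLc (j := k) (by omega)
    rw [hzero k hk, Real.sqrt_zero, zero_add] at h1
    exact (Real.sqrt_le_sqrt_iff ha).mp (h1.trans hsq)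
  · have h1 := sqrt_lam_le_add hL hs hsc (j := r) hr
    have h2 : hsSq (fun u v => crossCov P (Y 0) (X 0) u v
        - sampleCrossCov (fun i => Y i ω) (fun i => X i ω) n u v) = covError P Y X n ω := by
      unfold covError hsSq
      exact lintegral_congr fun p => by rw [← neg_sq, neg_sub]
    rw [h2] at h1
    set L := lam (crossCov P (Y 0) (X 0)) r with hLdef
    have hL0 : 0 ≤ L := lam_nonneg _ _
    have h3 : Real.sqrt (L / 4) = Real.sqrt L / 2 := by
      rw [Real.sqrt_div hL0]
      congr 1
      rw [show (4 : ℝ) = 2 ^ 2 by norm_num, Real.sqrt_sq zero_le_two]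
    -- The error uses up at most half of `√L`; the other half survives, which explains the factor
    -- `1/4` after squaring.
    have h4 : Real.sqrt a ≤ Real.sqrt L / 2 := h3 ▸ Real.sqrt_le_sqrt hle
    have h5 : Real.sqrt (L / 4) ≤ Real.sqrt (lamHat Y X n ω r) := by
      rw [h3]
      have : Real.sqrt L ≤ Real.sqrt (lamHat Y X n ω r) + Real.sqrt a := h1.trans (by
        gcongr; exact le_rfl)
      linarith
    exact (Real.sqrt_le_sqrt_iff (lam_nonneg _ _)).mp h5

/-- The exceptional event, of probability tending to zero, outside of which both criteria select
the correlation dimension. -/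
lemma exists_exceptional_events (h : IsMixingCurveModel P Y X) {r d : ℕ} (hrd : r < d)
    (hpos : 1 ≤ r → 0 < lam (crossCov P (Y 0) (X 0)) r)
    (hzero : ∀ k, r < k → lam (crossCov P (Y 0) (X 0)) k = 0)
    {c τ₁ τ₂ : ℝ} (hc : 0 < c) (hτ₁ : 0 < τ₁) (hτ₂ : 0 < τ₂)
    {g : ℕ → ℝ} (hg_pos : ∀ n, 1 ≤ n → 0 < g n)
    (hg_infty : Tendsto (fun n : ℕ => (n : ℝ) * g n) atTop atTop)
    (hg_zero : Tendsto g atTop (𝓝 0)) :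
    ∃ B : ℕ → Set Ω, Tendsto (fun n => P (B n)) atTop (𝓝 0) ∧
      ∀ᶠ n in atTop, ∀ ω ∉ B n, ∀ q < d, q ≠ r →
        IC₁ d τ₁ (g n) (lamHat Y X n ω) r < IC₁ d τ₁ (g n) (lamHat Y X n ω) q ∧
        IC₂ d c τ₂ (g n) (lamHat Y X n ω) r < IC₂ d c τ₂ (g n) (lamHat Y X n ω) q := by
  -- Small enough that the noise level `ε g(n)` lies strictly below one penalty step of either
  -- criterion. The factor `c` offsets the slope `1 / c` of the logarithm at `c`.
  set ε : ℝ := min (τ₁ / 2) (τ₂ * c / 2) with hε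
  have hε0 : 0 < ε := by positivity
  have hd : (0 : ℝ) < d := by exact_mod_cast (by omega : 0 < d)
  set N : Set Ω := {ω | ¬ ∀ i, MemLp (Y i ω) 2 volume ∧ MemLp (X i ω) 2 volume} with hN
  have hN0 : P N = 0 := h.ae_memLp
  refine ⟨fun n => N ∪ {ω | ENNReal.ofReal (ε * g n) ≤ covError P Y X n ω}, ?_, ?_⟩
  · have ha : Tendsto (fun n : ℕ => (n : ℝ) * (ε * g n)) atTop atTop := by
      simp_rw [mul_left_comm _ ε]
      exact hg_infty.const_mul_atTop hε0
    refine tendsto_of_tendsto_of_tendsto_of_le_of_le tendsto_const_nhds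
      (h.tendsto_measure_covError ha) (fun n => zero_le) fun n => ?_
    exact (measure_union_le _ _).trans (by rw [hN0, zero_add])
  · set L := lam (crossCov P (Y 0) (X 0)) r with hLdef
    have hεg : Tendsto (fun n => ε * g n) atTop (𝓝 0) := by simpa using hg_zero.const_mul ε
    have hpen : ∀ τ : ℝ, Tendsto (fun n => τ * d * g n) atTop (𝓝 0) := fun τ => by
      simpa using hg_zero.const_mul (τ * d)
    have ev1 : ∀ᶠ n in atTop, 1 ≤ r → ε * g n ≤ L / 4 := by
      by_cases hr : 1 ≤ r
      · filter_upwards [hεg.eventually_le_const (by have := hpos hr; positivity : 0 < L / 4)]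
          with n hn using fun _ => hn
      · exact .of_forall fun n hr' => absurd hr' hr
    have ev2 : ∀ᶠ n in atTop, 1 ≤ r → τ₁ * d * g n < 1 / (d : ℝ) ^ 2 * (L / 4) := by
      by_cases hr : 1 ≤ r
      · filter_upwards [(hpen τ₁).eventually_lt_const
          (by have := hpos hr; positivity : 0 < 1 / (d : ℝ) ^ 2 * (L / 4))] with n hn using fun _ => hn
      · exact .of_forall fun n hr' => absurd hr' hr
    have ev3 : ∀ᶠ n in atTop, 1 ≤ r →
        τ₂ * d * g n < Real.log (1 + 1 / (d : ℝ) ^ 2 * (L / 4) / (c + 1)) := by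
      by_cases hr : 1 ≤ r
      · have hlog : 0 < Real.log (1 + 1 / (d : ℝ) ^ 2 * (L / 4) / (c + 1)) := by
          have := hpos hr
          have h0 : 0 < 1 / (d : ℝ) ^ 2 * (L / 4) / (c + 1) := by positivity
          exact Real.log_pos (by linarith)
        filter_upwards [(hpen τ₂).eventually_lt_const hlog] with n hn using fun _ => hn
      · exact .of_forall fun n hr' => absurd hr' hr
    filter_upwards [ev1, ev2, ev3, hεg.eventually_le_const one_pos, eventually_ge_atTop 1]
      with n h1 h2 h3 h4 hn ω hω q hq hqr
    have hg := hg_pos n hn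
    simp only [Set.mem_union, Set.mem_ofPred_eq, not_or, not_le, hN, not_not] at hω
    have ha0 : 0 ≤ ε * g n := by positivity
    obtain ⟨hsmall, hbig⟩ := h.lamHat_bounds hzero hω.1 ha0 hω.2
    have hl : ∀ k, 0 ≤ lamHat Y X n ω k := fun k => lam_nonneg _ _
    have hbig' : 1 ≤ r → L / 4 ≤ lamHat Y X n ω r := fun hr => hbig hr (h1 hr)
    have hτ₁' : ε * g n < τ₁ * g n :=
      mul_lt_mul_of_pos_right ((min_le_left _ _).trans_lt (by linarith)) hg
    have hτ₂' : ε * g n / c < τ₂ * g n := by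
      rw [div_lt_iff₀ hc, mul_right_comm]
      exact mul_lt_mul_of_pos_right
        ((min_le_right _ _).trans_lt (by have := mul_pos hτ₂ hc; linarith)) hg
    exact ⟨IC₁_lt hl ha0 hsmall hbig' hrd hτ₁ hg hτ₁' h2 hqr,
      IC₂_lt hl ha0 h4 hsmall (fun hr => by have := hpos hr; positivity) hbig' hrd hc hτ₂ hg
        hτ₂' h3 hqr⟩

end IsMixingCurveModel

lemma IsArgmin.eq_of_forall_lt {d r q : ℕ} {IC : ℕ → ℝ} (h : IsArgmin d IC q) (hrd : r < d)
    (hlt : ∀ q < d, q ≠ r → IC r < IC q) : q = r := by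
  by_contra hne
  exact absurd (h.2 r hrd) (not_le.mpr (hlt q h.1 hne))

end Consistency

end CurveReg

end

theorem theorem2
    {Ω : Type*} [MeasurableSpace Ω] (P : Measure Ω) [IsProbabilityMeasure P]
    -- the compact index sets and the curves, as jointly measurable processes
    (I₁ I₂ : Set ℝ) (hI₁ : IsCompact I₁) (hI₂ : IsCompact I₂)
    (Y : ℕ → Ω → I₁ → ℝ) (X : ℕ → Ω → I₂ → ℝ)
    (hY : ∀ i, Measurable fun p : Ω × I₁ => Y i p.1 p.2)
    (hX : ∀ i, Measurable fun p : Ω × I₂ => X i p.1 p.2)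
    (hY0 : ∀ i u, ∫ ω, Y i ω u ∂P = 0)
    (hX0 : ∀ i v, ∫ ω, X i ω v ∂P = 0)
    -- stationarity, mixing and moments
    (hstat : CurveReg.StrictlyStationary P fun i ω => (Y i ω, X i ω))
    (hmix : ∑' k : ℕ, ((k + 1 : ℕ) : ℝ≥0∞) *
      CurveReg.psiMixing P (fun i ω => (Y i ω, X i ω)) (k + 1) ^ (1 / 2 : ℝ) < ∞)
    (hmom : ∀ i, ∫⁻ ω, ((∫⁻ u, ENNReal.ofReal (Y i ω u ^ 2))
      + ∫⁻ v, ENNReal.ofReal (X i ω v ^ 2)) ^ 2 ∂P < ∞)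
    -- the correlation dimension: `λ₁ > ⋯ > λ_r > 0 = λ_{r+1} = ⋯`
    (r d : ℕ) (hrd : r < d)
    (hlam_anti : StrictAntiOn (CurveReg.lam (CurveReg.crossCov P (Y 0) (X 0))) (Set.Icc 1 r))
    (hlam_pos : ∀ k ∈ Set.Icc 1 r, 0 < CurveReg.lam (CurveReg.crossCov P (Y 0) (X 0)) k)
    (hlam_zero : ∀ k, r < k → CurveReg.lam (CurveReg.crossCov P (Y 0) (X 0)) k = 0)
    -- the constants and the penalty of the criteria
    (c τ₁ τ₂ : ℝ) (hc : 0 < c) (hτ₁ : 0 < τ₁) (hτ₂ : 0 < τ₂)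
    (g : ℕ → ℝ) (hg_pos : ∀ n, 1 ≤ n → 0 < g n)
    (hg_infty : Tendsto (fun n : ℕ => (n : ℝ) * g n) atTop atTop)
    (hg_zero : Tendsto g atTop (𝓝 0)) :
    (∀ q, q < d → q ≠ r →
      CurveReg.ProbTendsToOne P (fun n => {ω |
        CurveReg.IC₁ d τ₁ (g n) (CurveReg.lamHat Y X n ω) r
          < CurveReg.IC₁ d τ₁ (g n) (CurveReg.lamHat Y X n ω) q}) ∧
      CurveReg.ProbTendsToOne P (fun n => {ω |
        CurveReg.IC₂ d c τ₂ (g n) (CurveReg.lamHat Y X n ω) r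
          < CurveReg.IC₂ d c τ₂ (g n) (CurveReg.lamHat Y X n ω) q})) ∧
    (∀ rhat : ℕ → Ω → ℕ,
      (∀ n ω, CurveReg.IsArgmin d
        (CurveReg.IC₁ d τ₁ (g n) (CurveReg.lamHat Y X n ω)) (rhat n ω)) →
      CurveReg.ProbTendsToOne P (fun n => {ω | rhat n ω = r})) ∧
    (∀ rhat : ℕ → Ω → ℕ,
      (∀ n ω, CurveReg.IsArgmin d
        (CurveReg.IC₂ d c τ₂ (g n) (CurveReg.lamHat Y X n ω)) (rhat n ω)) →
      CurveReg.ProbTendsToOne P (fun n => {ω | rhat n ω = r})) := by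
  -- Compactness makes Lebesgue measure on the index set finite, as Tonelli's and Fubini's theorems
  -- require.
  have : SFinite (volume : Measure I₁) := by
    have : IsFiniteMeasure (volume : Measure I₁) :=
      ⟨by rw [Measure.Subtype.volume_univ hI₁.measurableSet.nullMeasurableSet]
          exact hI₁.measure_lt_top⟩
    infer_instance
  have : SFinite (volume : Measure I₂) := by
    have : IsFiniteMeasure (volume : Measure I₂) :=
      ⟨by rw [Measure.Subtype.volume_univ hI₂.measurableSet.nullMeasurableSet]
          exact hI₂.measure_lt_top⟩
    infer_instance
  have hmodel : CurveReg.IsMixingCurveModel P Y X := ⟨hY, hX, hY0, hX0, hstat, hmix, hmom⟩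
  obtain ⟨B, hB, hev⟩ := hmodel.exists_exceptional_events hrd
    (fun hr => hlam_pos r ⟨hr, le_rfl⟩) hlam_zero hc hτ₁ hτ₂ hg_pos hg_infty hg_zero
  refine ⟨fun q hq hqr => ⟨?_, ?_⟩, fun rhat hrhat => ?_, fun rhat hrhat => ?_⟩
  all_goals
    refine CurveReg.probTendsToOne_of_compl_subset hB (hev.mono fun n hn ω hω => ?_)
    by_contra hωB
    refine hω ?_
  · exact (hn ω hωB q hq hqr).1
  · exact (hn ω hωB q hq hqr).2
  · exact (hrhat n ω).eq_of_forall_lt hrd fun q hq hqr => (hn ω hωB q hq hqr).1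
  · exact (hrhat n ω).eq_of_forall_lt hrd fun q hq hqr => (hn ω hωB q hq hqr).2
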